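/- Let $\Gamma$ be a finite group, $k$ a field whose characteristic does not divide $|\Gamma|$, and $G$ an affine algebraic group over $k$ with a homomorphism $\rho\colon\Gamma\to\operatorname{Aut}(G)$, $\gamma\mapsto\gamma_G$. Let $\pi\colon\tilde X\to X$ be a (possibly ramified) $\Gamma$-covering of $k$-schemes: $\pi$ is finite and flat, $\Gamma$ is identified with the group of automorphisms $\gamma_{\tilde X}$ of $\tilde X$ over $X$, and over a dense open subscheme of $X$ the scheme $\tilde X$ is an étale $\Gamma$-torsor. For a $k$-scheme $T$, a $(\Gamma,G)$-bundle on $\tilde X\times T$ is a right $G$-torsor $\mathcal Q$ (for the étale topology) on $\tilde X\times T$ with a left action of $\Gamma$ on its total space lifting the action on $\tilde X\times T$ (trivial on $T$) and such that $\gamma(qg)=\gamma(q)\gamma_G(g)$. Two $(\Gamma,G)$-bundles $\mathcal Q_1,\mathcal Q_2$ on $\tilde X\times T$ have the same local type if for every geometric point $x$ of $X\times T$ there is a $\Gamma$-invariant isomorphism of $G$-bundles between their pullbacks to the fibre of $\tilde X\times T\to X\times T$ over $x$. Fix a $(\Gamma,G)$-bundle $\mathcal P$ on $\tilde X$, and let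 $\mathcal H_{\mathcal P}=(\pi_*\mathscr{I}\!so_G(\mathcal P,\mathcal P))^\Gamma$ be the group over $X$ of $\Gamma$-invariants in the Weil restriction of the group of automorphisms of the $G$-bundle $\mathcal P$, where $\gamma$ acts by $\phi\mapsto\gamma_{\mathcal P}\circ\phi\circ\gamma_{\mathcal P}^{-1}$; by adjunction $\pi^*\mathcal H_{\mathcal P}$ acts on $\mathcal P$ on the left. Let $\mathcal Bun_{\mathcal H_{\mathcal P}}$ be the stack over $k$ whose objects over $T$ are the $\mathcal H_{\mathcal P}$-torsors (for the étale topology) on $X\times T$, and $\mathcal Bun^{\mathcal P}_{(\Gamma,G)}$ the stack whose objects over $T$ are the $(\Gamma,G)$-bundles on $\tilde X\times T$ with the same local type as the pullback $\mathcal P_T$ of $\mathcal P$ to $\tilde X\times T$. Then for every $T$ and every $\mathcal H_{\mathcal P}$-torsor $\mathcal F$ on $X\times T$, the contracted product $\pi^*\mathcal F\times^{\pi^*\mathcal H_{\mathcal P}}\mathcal P_T$ (the étale sheaf quotient of $\pi^*\mathcal F\times_{\tilde X\times T}\mathcal P_T$ by $(fh,p)\sim(f,hp)$), with the actions $[f,p]g=[f,pg]$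 and $\gamma[f,p]=[f,\gamma_{\mathcal P}(p)]$, is a $(\Gamma,G)$-bundle on $\tilde X\times T$ with the same local type as $\mathcal P_T$; and $\mathcal F\mapsto\pi^*\mathcal F\times^{\pi^*\mathcal H_{\mathcal P}}\mathcal P_T$, with $[f,p]\mapsto[u(f),p]$ on morphisms $u$, defines a morphism of stacks $\mathcal Bun_{\mathcal H_{\mathcal P}}\to\mathcal Bun^{\mathcal P}_{(\Gamma,G)}$. -/

import Mathlib

open CategoryTheory Limits MonoidalCategory CartesianMonoidalCategory Opposite AlgebraicGeometry
open scoped MonObj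

universe u v

noncomputable section

namespace GammaBundle

/-! ### The big étale site of a field -/

/-- The category of schemes over the field `k`. -/
abbrev Sch (k : Type u) [Field k] : Type (u + 1) := Over (Spec (CommRingCat.of k))

/-- The (big) étale topology on `k`-schemes. -/
abbrev etaleSite (k : Type u) [Field k] : GrothendieckTopology (Sch k) :=
  Scheme.etaleTopology.over (Spec (CommRingCat.of k))

/-- Étale sheaves (of possibly large sets) on the category of `k`-schemes. -/
abbrev EtSheaf (k : Type u) [Field k] := Sheaf (etaleSite k) (Type (u + 1))

section Sections

variable {k : Type u} [Field k]

/-- The `S`-valued points of an étale sheaf. -/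
abbrev EtSheaf.Sec (F : EtSheaf k) (S : Sch k) : Type (u + 1) := F.obj.obj (op S)

/-- Restriction of an `S`-valued point along `a : S' ⟶ S`. -/
def EtSheaf.res (F : EtSheaf k) {S S' : Sch k} (a : S' ⟶ S) (x : F.Sec S) : F.Sec S' :=
  F.obj.map a.op x

lemma EtSheaf.res_id (F : EtSheaf k) {S : Sch k} (x : F.Sec S) : F.res (𝟙 S) x = x := by
  simp [EtSheaf.res]

lemma EtSheaf.res_comp (F : EtSheaf k) {S S' S'' : Sch k} (a : S' ⟶ S) (b : S'' ⟶ S')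
    (x : F.Sec S) : F.res (b ≫ a) x = F.res b (F.res a x) := by
  simp [EtSheaf.res]

/-- The effect of a morphism of étale sheaves on `S`-valued points. -/
def EtSheaf.ap {F F' : EtSheaf k} (u : F ⟶ F') {S : Sch k} (x : F.Sec S) : F'.Sec S :=
  u.hom.app (op S) x

lemma EtSheaf.ap_res {F F' : EtSheaf k} (u : F ⟶ F') {S S' : Sch k} (a : S' ⟶ S) (x : F.Sec S) :
    EtSheaf.ap u (F.res a x) = F'.res a (EtSheaf.ap u x) :=
  NatTrans.naturality_apply u.hom a.op x

instance etaleSite_subcanonical : (etaleSite k).Subcanonical := by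
  have h : Scheme.etaleTopology.{u} ≤ Scheme.fppfTopology := by
    apply Scheme.grothendieckTopology_monotone
    intro X Y f hf
    constructor <;> infer_instance
  have : Scheme.etaleTopology.{u}.Subcanonical := GrothendieckTopology.Subcanonical.of_le h
  infer_instance

/-- The étale sheaf `F × T`, for an étale sheaf `F` and a `k`-scheme `T`. -/
def EtSheaf.prod (F : EtSheaf k) (T : Sch k) : EtSheaf k where
  obj :=
    { obj := fun S => F.Sec S.unop × (S.unop ⟶ T)
      map := fun a => ↾fun x => (F.res a.unop x.1, a.unop ≫ x.2)
      map_id := fun S => by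
        ext x
        · simp [EtSheaf.res]
        · simp
      map_comp := fun a b => by
        ext x
        · simp [EtSheaf.res]
        · simp }
  property := by
    rw [isSheaf_iff_isSheaf_of_type]
    intro S R hR x hx
    have h1 := (isSheaf_iff_isSheaf_of_type _ _).1 F.property R hR
    have h2 := GrothendieckTopology.Subcanonical.isSheaf_of_isRepresentable
      (J := etaleSite k) (yoneda.obj T) R hR
    have c1 : Presieve.FamilyOfElements.Compatible
        (P := F.obj) (R := R.arrows) (fun Y f hf => (x f hf).1) := by
      intro Y₁ Y₂ Z g₁ g₂ f₁ f₂ k₁ k₂ e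
      exact congrArg Prod.fst (hx g₁ g₂ k₁ k₂ e)
    have c2 : Presieve.FamilyOfElements.Compatible
        (P := yoneda.obj T) (R := R.arrows) (fun Y f hf => (x f hf).2) := by
      intro Y₁ Y₂ Z g₁ g₂ f₁ f₂ k₁ k₂ e
      exact congrArg Prod.snd (hx g₁ g₂ k₁ k₂ e)
    obtain ⟨t1, ht1, u1⟩ := h1 _ c1
    obtain ⟨t2, ht2, u2⟩ := h2 _ c2
    refine ⟨(t1, t2), fun Y f hf => Prod.ext (ht1 f hf) (ht2 f hf), fun y hy => ?_⟩
    exact Prod.ext (u1 _ fun Y f hf => congrArg Prod.fst (hy f hf))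
      (u2 _ fun Y f hf => congrArg Prod.snd (hy f hf))

end Sections

/-! ### Coverings -/

/-- A morphism `total ⟶ base` of `k`-schemes with an action of the abstract group `Γ` on `total`
by automorphisms over `base`.  (As `Aut` is a group under composition of maps, `act` is a left
action.) -/
structure EquivMap (k : Type u) [Field k] (Γ : Type v) [Group Γ] where
  total : Sch k
  base : Sch k
  map : total ⟶ base
  act : Γ →* Aut total
  act_map : ∀ σ, (act σ).hom ≫ map = map

namespace EquivMap

variable {k : Type u} [Field k] {Γ : Type v} [Group Γ]

/-- The morphism `Γ × X̃ ⟶ X̃ ×_X X̃`, `(σ, x) ↦ (σ x, x)`, of schemes. -/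
def actionMap [Finite Γ] (C : EquivMap k Γ) :
    (∐ fun _ : Γ => C.total.left) ⟶ pullback C.map.left C.map.left :=
  Sigma.desc fun σ => pullback.lift (C.act σ).hom.left (𝟙 _)
    (by rw [← Over.comp_left, C.act_map, Category.id_comp])

/-- A (possibly ramified) `Γ`-covering: a finite flat morphism `π : X̃ ⟶ X` such that `Γ` is, via
its action, the group of automorphisms of `X̃` over `X`, and such that over some dense open `U` of
`X` the scheme `X̃` is an étale `Γ`-torsor. -/
structure IsRamifiedCovering [Finite Γ] (C : EquivMap k Γ) : Prop where
  finite : IsFinite C.map.left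
  flat : Flat C.map.left
  aut : ∀ τ : Aut C.total, τ.hom ≫ C.map = C.map → ∃! σ : Γ, C.act σ = τ
  generically_torsor : ∃ U : C.base.left.Opens, Dense (U : Set C.base.left) ∧
    Etale (C.map.left ∣_ U) ∧ Surjective (C.map.left ∣_ U) ∧
    IsIso (C.actionMap ∣_
      ((pullback.fst C.map.left C.map.left ≫ C.map.left) ⁻¹ᵁ U))

/-- The base change `X̃ × T ⟶ X × T` to a `k`-scheme `T`, `Γ` acting on the first factor. -/
def prod (C : EquivMap k Γ) (T : Sch k) : EquivMap k Γ where
  total := C.total ⊗ T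
  base := C.base ⊗ T
  map := C.map ▷ T
  act := ((tensorRight T).mapAut C.total).comp C.act
  act_map σ := by
    change (C.act σ).hom ▷ T ≫ C.map ▷ T = C.map ▷ T
    rw [← comp_whiskerRight, C.act_map]

end EquivMap

/-! ### `(Γ, G)`-bundles -/

section Bundles

variable {k : Type u} [Field k] {Γ : Type v} [Group Γ]

/-- Given a left action `ρ` of `Γ` on the group scheme `G` by group automorphisms, a
`(Γ, G)`-bundle on `X̃` is a right `G`-torsor for the étale topology on `X̃`, with a left action of
`Γ` on its total space that lifts the action on `X̃` and satisfies `σ (p g) = σ (p) σ (g)`.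

The total space is given through its functor of points, an étale sheaf on `k`-schemes with a map
to `X̃`. -/
structure GBundle {G : Grp (Sch k)} (ρ : Γ →* Aut G) (C : EquivMap k Γ) where
  /-- the total space -/
  sheaf : EtSheaf k
  /-- the projection to `X̃` -/
  proj : ∀ {S : Sch k}, sheaf.Sec S → (S ⟶ C.total)
  proj_res : ∀ {S S' : Sch k} (a : S' ⟶ S) (p : sheaf.Sec S), proj (sheaf.res a p) = a ≫ proj p
  /-- the right action of `G` -/
  smul : ∀ {S : Sch k}, sheaf.Sec S → (S ⟶ G.X) → sheaf.Sec S
  smul_one : ∀ {S : Sch k} (p : sheaf.Sec S), smul p 1 = p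
  smul_mul : ∀ {S : Sch k} (p : sheaf.Sec S) (g g' : S ⟶ G.X),
    smul p (g * g') = smul (smul p g) g'
  smul_res : ∀ {S S' : Sch k} (a : S' ⟶ S) (p : sheaf.Sec S) (g : S ⟶ G.X),
    sheaf.res a (smul p g) = smul (sheaf.res a p) (a ≫ g)
  proj_smul : ∀ {S : Sch k} (p : sheaf.Sec S) (g : S ⟶ G.X), proj (smul p g) = proj p
  simply_transitive : ∀ {S : Sch k} (p p' : sheaf.Sec S), proj p = proj p' → ∃! g, smul p g = p'
  locally_nonempty : ∀ {S : Sch k} (y : S ⟶ C.total), ∃ R ∈ etaleSite k S,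
    ∀ {S' : Sch k} (a : S' ⟶ S), R.arrows a → ∃ p : sheaf.Sec S', proj p = a ≫ y
  /-- the left action of `Γ` -/
  gsmul : ∀ {S : Sch k}, Γ → sheaf.Sec S → sheaf.Sec S
  gsmul_one : ∀ {S : Sch k} (p : sheaf.Sec S), gsmul 1 p = p
  gsmul_mul : ∀ {S : Sch k} (σ τ : Γ) (p : sheaf.Sec S), gsmul (σ * τ) p = gsmul σ (gsmul τ p)
  gsmul_res : ∀ {S S' : Sch k} (a : S' ⟶ S) (σ : Γ) (p : sheaf.Sec S),
    sheaf.res a (gsmul σ p) = gsmul σ (sheaf.res a p)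
  proj_gsmul : ∀ {S : Sch k} (σ : Γ) (p : sheaf.Sec S), proj (gsmul σ p) = proj p ≫ (C.act σ).hom
  gsmul_smul : ∀ {S : Sch k} (σ : Γ) (p : sheaf.Sec S) (g : S ⟶ G.X),
    gsmul σ (smul p g) = smul (gsmul σ p) (g ≫ (ρ σ).hom.hom.hom)

variable {G : Grp (Sch k)} {ρ : Γ →* Aut G} {C : EquivMap k Γ}

namespace GBundle

/-- The points of the bundle lying over a given point `y` of `X̃`. -/
def Fib (P : GBundle ρ C) {S : Sch k} (y : S ⟶ C.total) : Type (u + 1) :=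
  {p : P.sheaf.Sec S // P.proj p = y}

/-- Restriction of points of the fibres. -/
def Fib.res {P : GBundle ρ C} {S S' : Sch k} (a : S' ⟶ S) {y : S ⟶ C.total} (p : P.Fib y) :
    P.Fib (a ≫ y) :=
  ⟨P.sheaf.res a p.1, by rw [P.proj_res, p.2]⟩

/-- The `G`-action on the fibres. -/
def Fib.smul {P : GBundle ρ C} {S : Sch k} {y : S ⟶ C.total} (p : P.Fib y) (g : S ⟶ G.X) :
    P.Fib y :=
  ⟨P.smul p.1 g, by rw [P.proj_smul, p.2]⟩

/-- The action of `σ : Γ` carries the fibre at `y` to the fibre at `σ y`. -/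
def Fib.gsmul {P : GBundle ρ C} {S : Sch k} {y : S ⟶ C.total} (σ : Γ) (p : P.Fib y) :
    P.Fib (y ≫ (C.act σ).hom) :=
  ⟨P.gsmul σ p.1, by rw [P.proj_gsmul, p.2]⟩

/-- The base change of a `(Γ, G)`-bundle on `X̃` to a `(Γ, G)`-bundle on `X̃ × T`; its total space
is `P × T`. -/
def prod (P : GBundle ρ C) (T : Sch k) : GBundle ρ (C.prod T) where
  sheaf := P.sheaf.prod T
  proj x := lift (P.proj x.1) x.2
  proj_res a x := by
    change lift (P.proj (P.sheaf.res a x.1)) (a ≫ x.2) = _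
    rw [P.proj_res]
    exact (comp_lift _ _ _).symm
  smul x g := (P.smul x.1 g, x.2)
  smul_one x := Prod.ext (P.smul_one x.1) rfl
  smul_mul x g g' := Prod.ext (P.smul_mul x.1 g g') rfl
  smul_res a x g := Prod.ext (P.smul_res a x.1 g) rfl
  proj_smul x g := by
    change lift (P.proj (P.smul x.1 g)) x.2 = _
    rw [P.proj_smul]
  simply_transitive x x' h := by
    have h1 : P.proj x.1 = P.proj x'.1 := by simpa using congrArg (· ≫ fst _ _) h
    have h2 : x.2 = x'.2 := by simpa using congrArg (· ≫ snd _ _) h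
    obtain ⟨g, hg, hu⟩ := P.simply_transitive x.1 x'.1 h1
    exact ⟨g, Prod.ext hg h2, fun g' hg' => hu g' (congrArg Prod.fst hg')⟩
  locally_nonempty {S} y := by
    change S ⟶ C.total ⊗ T at y
    obtain ⟨R, hR, h⟩ := P.locally_nonempty (y ≫ fst C.total T)
    refine ⟨R, hR, fun {S'} a ha => ?_⟩
    obtain ⟨p, hp⟩ := h a ha
    have e : lift (P.proj p) (a ≫ y ≫ snd C.total T) = a ≫ y := by
      rw [hp, ← comp_lift, ← comp_lift, lift_fst_snd, Category.comp_id]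
    exact ⟨(p, a ≫ y ≫ snd C.total T), e⟩
  gsmul σ x := (P.gsmul σ x.1, x.2)
  gsmul_one x := Prod.ext (P.gsmul_one x.1) rfl
  gsmul_mul σ τ x := Prod.ext (P.gsmul_mul σ τ x.1) rfl
  gsmul_res a σ x := Prod.ext (P.gsmul_res a σ x.1) rfl
  proj_gsmul σ x := by
    change lift (P.proj (P.gsmul σ x.1)) x.2 = lift (P.proj x.1) x.2 ≫ (C.act σ).hom ▷ T
    rw [P.proj_gsmul, lift_whiskerRight]
  gsmul_smul σ x g := Prod.ext (P.gsmul_smul σ x.1 g) rfl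

end GBundle

/-! ### The group scheme `H_P`, and local types -/

/-- The points over `s : S ⟶ X` of the Weil restriction `π_* Iso_G(P, Q)` along `π : X̃ ⟶ X`, for
`(Γ, G)`-bundles `P`, `Q` on `X̃`: these are the sections of `Iso_G(P, Q)` over `S ×_X X̃`, i.e. the
isomorphisms of `G`-bundles between the pullbacks of `P` and `Q` to `S ×_X X̃`.

An `S'`-point of `S ×_X X̃` is a pair `(a, y)` of points of `S` and `X̃` with the same image in `X`,
and the fibre at this point of the pullback of `P` is the fibre of `P` at `y`. -/
@[ext]
structure WeilIso (P Q : GBundle ρ C) {S : Sch k} (s : S ⟶ C.base) where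
  toEquiv : ∀ {S' : Sch k} (a : S' ⟶ S) (y : S' ⟶ C.total), a ≫ s = y ≫ C.map → P.Fib y ≃ Q.Fib y
  natural : ∀ {S' S'' : Sch k} (b : S'' ⟶ S') (a : S' ⟶ S) (y : S' ⟶ C.total)
    (h : a ≫ s = y ≫ C.map) (h' : (b ≫ a) ≫ s = (b ≫ y) ≫ C.map) (p : P.Fib y),
    toEquiv (b ≫ a) (b ≫ y) h' (p.res b) = (toEquiv a y h p).res b
  equivariant : ∀ {S' : Sch k} (a : S' ⟶ S) (y : S' ⟶ C.total) (h : a ≫ s = y ≫ C.map)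
    (p : P.Fib y) (g : S' ⟶ G.X), toEquiv a y h (p.smul g) = (toEquiv a y h p).smul g

namespace WeilIso

/-- `φ` is fixed by the action `φ ↦ σ_Q ∘ φ ∘ σ_P⁻¹` of `Γ` on the points of `π_* Iso_G(P, Q)`
(which covers the action of `Γ` on `S ×_X X̃`), that is, `φ` commutes with the actions of `Γ`. -/
def IsInvariant {P Q : GBundle ρ C} {S : Sch k} {s : S ⟶ C.base} (φ : WeilIso P Q s) : Prop :=
  ∀ (σ : Γ) {S' : Sch k} (a : S' ⟶ S) (y : S' ⟶ C.total) (h : a ≫ s = y ≫ C.map)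
    (h' : a ≫ s = (y ≫ (C.act σ).hom) ≫ C.map) (p : P.Fib y),
    φ.toEquiv a (y ≫ (C.act σ).hom) h' (p.gsmul σ) = (φ.toEquiv a y h p).gsmul σ

end WeilIso

/-- `P` and `Q` have the same local type at the geometric point `x` of `X`: there is a
`Γ`-invariant isomorphism of `G`-bundles between their pullbacks to `π⁻¹{x}`. -/
def SameLocalTypeAt (P Q : GBundle ρ C) {S : Sch k} (x : S ⟶ C.base) : Prop :=
  ∃ φ : WeilIso P Q x, φ.IsInvariant

/-- `P` and `Q` have the same local type, i.e. they have the same local type at every geometric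
point of `X`. -/
def SameLocalType (P Q : GBundle ρ C) : Prop :=
  ∀ (Ω : Type u) [Field Ω] [IsAlgClosed Ω] (x : Spec (CommRingCat.of Ω) ⟶ C.base.left),
    SameLocalTypeAt P Q (Over.homMk (U := Over.mk (x ≫ C.base.hom)) (V := C.base) x)

/-- The group functor `H_P = (π_* Iso_G(P, P))^Γ` over `X`: its points over `s : S ⟶ X`. -/
def HP (P : GBundle ρ C) {S : Sch k} (s : S ⟶ C.base) : Type (u + 1) :=
  {φ : WeilIso P P s // φ.IsInvariant}

namespace HP

variable {P : GBundle ρ C} {S : Sch k} {s : S ⟶ C.base}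

lemma ext' {φ ψ : HP P s} (h : ∀ {S' : Sch k} (a : S' ⟶ S) (y : S' ⟶ C.total)
    (e : a ≫ s = y ≫ C.map) (p : P.Fib y), φ.1.toEquiv a y e p = ψ.1.toEquiv a y e p) : φ = ψ := by
  apply Subtype.ext
  apply WeilIso.ext
  funext S' a y e
  exact Equiv.ext (h a y e)

instance : One (HP P s) where
  one := ⟨{ toEquiv := fun _ _ _ => Equiv.refl _
            natural := fun _ _ _ _ _ _ => rfl
            equivariant := fun _ _ _ _ _ => rfl }, fun _ _ _ _ _ _ _ => rfl⟩

/-- The product is composition: `(φ * ψ)(p) = φ (ψ p)`. -/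
instance : Mul (HP P s) where
  mul φ ψ :=
    ⟨{ toEquiv := fun a y h => (ψ.1.toEquiv a y h).trans (φ.1.toEquiv a y h)
       natural := fun b a y h h' p => by
        simp only [Equiv.trans_apply]
        rw [ψ.1.natural b a y h h', φ.1.natural b a y h h']
       equivariant := fun a y h p g => by
        simp only [Equiv.trans_apply]
        rw [ψ.1.equivariant, φ.1.equivariant] },
      fun σ S' a y h h' p => by
        simp only [Equiv.trans_apply]
        rw [ψ.2 σ a y h h', φ.2 σ a y h h']⟩

instance : Inv (HP P s) where
  inv φ :=
    ⟨{ toEquiv := fun a y h => (φ.1.toEquiv a y h).symm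
       natural := fun b a y h h' p => by
        rw [Equiv.symm_apply_eq, φ.1.natural b a y h h', Equiv.apply_symm_apply]
       equivariant := fun a y h p g => by
        rw [Equiv.symm_apply_eq, φ.1.equivariant, Equiv.apply_symm_apply] },
      fun σ S' a y h h' p => by
        rw [Equiv.symm_apply_eq, φ.2 σ a y h h', Equiv.apply_symm_apply]⟩

instance : Group (HP P s) where
  mul_assoc _ _ _ := rfl
  one_mul _ := rfl
  mul_one _ := rfl
  inv_mul_cancel φ := ext' fun a y e p => (φ.1.toEquiv a y e).symm_apply_apply p

/-- Restriction of points of `H_P` along `b : S' ⟶ S`. -/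
def res {S' : Sch k} (b : S' ⟶ S) (φ : HP P s) : HP P (b ≫ s) :=
  ⟨{ toEquiv := fun a y h => φ.1.toEquiv (a ≫ b) y (by rw [Category.assoc, h])
     natural := fun b' a y h h' p => by
      have := φ.1.natural b' (a ≫ b) y (by rw [Category.assoc, h])
        (by rw [Category.assoc, Category.assoc, h, Category.assoc]) p
      simpa only [Category.assoc] using this
     equivariant := fun a y h p g => φ.1.equivariant (a ≫ b) y _ p g },
    fun σ S' a y h h' p => φ.2 σ (a ≫ b) y _ _ p⟩

/-- The left action of `π^* H_P` on `P`: the value at a point `p` of `P` of a point `φ` of `H_P`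
with the same image `s` in `X`. -/
def smul (φ : HP P s) (p : P.sheaf.Sec S) (h : P.proj p ≫ C.map = s) : P.sheaf.Sec S :=
  (φ.1.toEquiv (𝟙 S) (P.proj p) (by rw [Category.id_comp, h]) ⟨p, rfl⟩).1

lemma proj_smul (φ : HP P s) (p : P.sheaf.Sec S) (h : P.proj p ≫ C.map = s) :
    P.proj (φ.smul p h) = P.proj p :=
  (φ.1.toEquiv (𝟙 S) (P.proj p) (by rw [Category.id_comp, h]) ⟨p, rfl⟩).2

lemma res_smul {S' : Sch k} (b : S' ⟶ S) (φ : HP P s) (p : P.sheaf.Sec S)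
    (h : P.proj p ≫ C.map = s) (h' : P.proj (P.sheaf.res b p) ≫ C.map = b ≫ s) :
    P.sheaf.res b (φ.smul p h) = (φ.res b).smul (P.sheaf.res b p) h' := by
  have key : ∀ (a a' : S' ⟶ S) (y y' : S' ⟶ C.total) (e : a ≫ s = y ≫ C.map)
      (e' : a' ≫ s = y' ≫ C.map) (q : P.Fib y) (q' : P.Fib y'), a = a' → q.1 = q'.1 →
      (φ.1.toEquiv a y e q).1 = (φ.1.toEquiv a' y' e' q').1 := by
    rintro a _ y y' e e' q q' rfl hq
    obtain rfl : y = y' := by rw [← q.2, ← q'.2, hq]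
    obtain rfl : q = q' := Subtype.ext hq
    rfl
  have := congrArg Subtype.val (φ.1.natural b (𝟙 S) (P.proj p) (by rw [Category.id_comp, h])
    (by rw [Category.comp_id, Category.assoc, h]) ⟨p, rfl⟩)
  exact this.symm.trans (key _ _ _ _ _ _ _ _ (by simp) rfl)

end HP

/-! ### `H_P`-bundles and the contracted product -/

/-- An `H_P`-bundle on `X × T`: a right torsor, for the étale topology on `X × T`, under (the
pullback to `X × T` of) the group `H_P` over `X`. -/
structure HBundle (P : GBundle ρ C) (T : Sch k) where
  /-- the total space -/
  sheaf : EtSheaf k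
  /-- the projection to `X × T` -/
  proj : ∀ {S : Sch k}, sheaf.Sec S → (S ⟶ C.base ⊗ T)
  proj_res : ∀ {S S' : Sch k} (a : S' ⟶ S) (f : sheaf.Sec S), proj (sheaf.res a f) = a ≫ proj f
  /-- the right action of `H_P`, defined for pairs of points with the same image `x` in `X` -/
  act : ∀ {S : Sch k} {x : S ⟶ C.base} (f : sheaf.Sec S) (_ : HP P x),
    proj f ≫ fst C.base T = x → sheaf.Sec S
  proj_act : ∀ {S : Sch k} {x : S ⟶ C.base} (f : sheaf.Sec S) (h : HP P x)
    (e : proj f ≫ fst C.base T = x), proj (act f h e) = proj f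
  act_one : ∀ {S : Sch k} {x : S ⟶ C.base} (f : sheaf.Sec S) (e : proj f ≫ fst C.base T = x),
    act f (1 : HP P x) e = f
  act_mul : ∀ {S : Sch k} {x : S ⟶ C.base} (f : sheaf.Sec S) (h h' : HP P x)
    (e : proj f ≫ fst C.base T = x) (e' : proj (act f h e) ≫ fst C.base T = x),
    act f (h * h') e = act (act f h e) h' e'
  act_res : ∀ {S S' : Sch k} (a : S' ⟶ S) {x : S ⟶ C.base} (f : sheaf.Sec S) (h : HP P x)
    (e : proj f ≫ fst C.base T = x) (e' : proj (sheaf.res a f) ≫ fst C.base T = a ≫ x),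
    sheaf.res a (act f h e) = act (sheaf.res a f) (h.res a) e'
  simply_transitive : ∀ {S : Sch k} (f f' : sheaf.Sec S), proj f = proj f' →
    ∃! h : HP P (proj f ≫ fst C.base T), act f h rfl = f'
  locally_nonempty : ∀ {S : Sch k} (s : S ⟶ C.base ⊗ T), ∃ R ∈ etaleSite k S,
    ∀ {S' : Sch k} (a : S' ⟶ S), R.arrows a → ∃ f : sheaf.Sec S', proj f = a ≫ s

namespace HBundle

variable {P : GBundle ρ C} {T : Sch k} (F : HBundle P T)

/-- The points of `π^* F ×_{X̃ × T} (P × T)`: since `F` maps to `X × T`, these are the pairs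
`(f, p)` of a point of `F` and a point of `P` with the same image in `X`. -/
def Pair (S : Sch k) : Type (u + 1) :=
  {x : F.sheaf.Sec S × P.sheaf.Sec S // F.proj x.1 ≫ fst C.base T = P.proj x.2 ≫ C.map}

/-- The pair `(f, p)`. -/
def pair {S : Sch k} (f : F.sheaf.Sec S) (p : P.sheaf.Sec S)
    (e : F.proj f ≫ fst C.base T = P.proj p ≫ C.map) : F.Pair S := ⟨(f, p), e⟩

/-- Restriction of pairs. -/
def Pair.res {F : HBundle P T} {S S' : Sch k} (a : S' ⟶ S) (x : F.Pair S) : F.Pair S' :=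
  ⟨(F.sheaf.res a x.1.1, P.sheaf.res a x.1.2), by
    rw [F.proj_res, P.proj_res, Category.assoc, Category.assoc, x.2]⟩

/-- The action of `G` on pairs, `(f, p) g = (f, p g)`. -/
def Pair.smul {F : HBundle P T} {S : Sch k} (x : F.Pair S) (g : S ⟶ G.X) : F.Pair S :=
  F.pair x.1.1 (P.smul x.1.2 g) (by rw [P.proj_smul, x.2])

/-- The action of `Γ` on pairs, `σ (f, p) = (f, σ p)`. -/
def Pair.gsmul {F : HBundle P T} {S : Sch k} (σ : Γ) (x : F.Pair S) : F.Pair S :=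
  F.pair x.1.1 (P.gsmul σ x.1.2) (by rw [P.proj_gsmul, Category.assoc, C.act_map, x.2])

/-- The relation `(f h, p) ∼ (f, h p)` for `h` a point of `H_P`. -/
inductive Rel {S : Sch k} : F.Pair S → F.Pair S → Prop
  | mk {x : S ⟶ C.base} (h : HP P x) (f : F.sheaf.Sec S) (p : P.sheaf.Sec S)
    (hf : F.proj f ≫ fst C.base T = x) (hp : P.proj p ≫ C.map = x) :
    Rel (F.pair (F.act f h hf) p (by rw [F.proj_act, hf, hp]))
      (F.pair f (h.smul p hp) (by rw [h.proj_smul, hf, hp]))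

lemma Rel.res {F : HBundle P T} {S S' : Sch k} (a : S' ⟶ S) {x y : F.Pair S} (h : F.Rel x y) :
    F.Rel (x.res a) (y.res a) := by
  obtain @⟨s, h, f, p, hf, hp⟩ := h
  have hf' : F.proj (F.sheaf.res a f) ≫ fst C.base T = a ≫ s := by
    rw [F.proj_res, Category.assoc, hf]
  have hp' : P.proj (P.sheaf.res a p) ≫ C.map = a ≫ s := by
    rw [P.proj_res, Category.assoc, hp]
  have := Rel.mk (h.res a) (F.sheaf.res a f) (P.sheaf.res a p) hf' hp'
  convert this using 1
  · exact Subtype.ext (Prod.ext (F.act_res a f h hf hf') rfl)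
  · exact Subtype.ext (Prod.ext rfl (h.res_smul a p hp hp'))

/-- The presheaf quotient of `π^* F ×_{X̃ × T} (P × T)` by `(f h, p) ∼ (f, h p)`. -/
def quotientPresheaf : (Sch k)ᵒᵖ ⥤ Type (u + 1) where
  obj S := Quot (F.Rel (S := S.unop))
  map a := ↾(Quot.map (Pair.res a.unop) fun _ _ h => h.res a.unop)
  map_id S := by
    ext x
    obtain ⟨x⟩ := x
    exact congrArg (Quot.mk _) (Subtype.ext (Prod.ext (EtSheaf.res_id _ _) (EtSheaf.res_id _ _)))
  map_comp a b := by
    ext x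
    obtain ⟨x⟩ := x
    exact congrArg (Quot.mk _)
      (Subtype.ext (Prod.ext (EtSheaf.res_comp _ _ _ _) (EtSheaf.res_comp _ _ _ _)))

/-- The contracted product `π^* F ×^{π^* H_P} P` (its total space): the étale sheaf quotient of
`π^* F ×_{X̃ × T} (P × T)` by `(f h, p) ∼ (f, h p)`. -/
def contractedProduct : EtSheaf k := (presheafToSheaf (etaleSite k) _).obj F.quotientPresheaf

/-- The class `[f, p]` in the contracted product of a pair `(f, p)`. -/
def cls {S : Sch k} (x : F.Pair S) : F.contractedProduct.Sec S :=
  (toSheafify (etaleSite k) F.quotientPresheaf).app (op S) (Quot.mk _ x)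

end HBundle

/-! ### The stacks -/

/-- The objects of the stack of `H_P`-bundles: a `k`-scheme `T` and an `H_P`-bundle on `X × T`. -/
structure BunH (P : GBundle ρ C) where
  T : Sch k
  bundle : HBundle P T

/-- A morphism `F ⟶ F'` over `base : T ⟶ T'` is an `H_P`-equivariant map of total spaces which
lies over `X × T ⟶ X × T'` (equivalently, an isomorphism from `F` to the pullback of `F'`). -/
@[ext]
structure BunH.Hom {P : GBundle ρ C} (F F' : BunH P) where
  base : F.T ⟶ F'.T
  map : F.bundle.sheaf ⟶ F'.bundle.sheaf
  proj_map : ∀ {S : Sch k} (f : F.bundle.sheaf.Sec S),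
    F'.bundle.proj (EtSheaf.ap map f) = F.bundle.proj f ≫ C.base ◁ base
  map_act : ∀ {S : Sch k} {x : S ⟶ C.base} (f : F.bundle.sheaf.Sec S) (h : HP P x)
    (e : F.bundle.proj f ≫ fst C.base F.T = x)
    (e' : F'.bundle.proj (EtSheaf.ap map f) ≫ fst C.base F'.T = x),
    EtSheaf.ap map (F.bundle.act f h e) = F'.bundle.act (EtSheaf.ap map f) h e'

instance (P : GBundle ρ C) : Category (BunH P) where
  Hom := BunH.Hom
  id F :=
    { base := 𝟙 _
      map := 𝟙 _
      proj_map := fun f => by simp [EtSheaf.ap]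
      map_act := fun _ _ _ _ => rfl }
  comp {F F' F''} u v :=
    { base := u.base ≫ v.base
      map := u.map ≫ v.map
      proj_map := fun f => by
        change F''.bundle.proj (EtSheaf.ap v.map (EtSheaf.ap u.map f)) = _
        rw [v.proj_map, u.proj_map, Category.assoc, ← MonoidalCategory.whiskerLeft_comp]
      map_act := fun {_ x} f h e e' => by
        have e'' : F'.bundle.proj (EtSheaf.ap u.map f) ≫ fst C.base F'.T = x := by
          rw [u.proj_map, Category.assoc, whiskerLeft_fst, e]
        change EtSheaf.ap v.map (EtSheaf.ap u.map _) = _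
        rw [u.map_act f h e e'', v.map_act _ h e'' e']
        rfl }
  id_comp _ := BunH.Hom.ext (Category.id_comp _) (Category.id_comp _)
  comp_id _ := BunH.Hom.ext (Category.comp_id _) (Category.comp_id _)
  assoc _ _ _ := BunH.Hom.ext (Category.assoc _ _ _) (Category.assoc _ _ _)

/-- The stack `Bun_{H_P}` of `H_P`-bundles, as a category over the category of `k`-schemes. -/
def bunH (P : GBundle ρ C) : BasedCategory (Sch k) where
  obj := BunH P
  p :=
    { obj := fun F => F.T
      map := fun u => BunH.Hom.base u }

/-- The objects of the stack `Bun^P_{(Γ,G)}`: a `k`-scheme `T` and a `(Γ, G)`-bundle on `X̃ × T`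
which has the same local type as `P × T`. -/
structure BunG (P : GBundle ρ C) where
  T : Sch k
  bundle : GBundle ρ (C.prod T)
  sameLocalType : SameLocalType (P.prod T) bundle

/-- A morphism `Q ⟶ Q'` over `base : T ⟶ T'` is a `Γ`- and `G`-equivariant map of total spaces
which lies over `X̃ × T ⟶ X̃ × T'` (equivalently, an isomorphism from `Q` to the pullback of
`Q'`). -/
@[ext]
structure BunG.Hom {P : GBundle ρ C} (Q Q' : BunG P) where
  base : Q.T ⟶ Q'.T
  map : Q.bundle.sheaf ⟶ Q'.bundle.sheaf
  proj_map : ∀ {S : Sch k} (q : Q.bundle.sheaf.Sec S),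
    Q'.bundle.proj (EtSheaf.ap map q) = Q.bundle.proj q ≫ C.total ◁ base
  map_smul : ∀ {S : Sch k} (q : Q.bundle.sheaf.Sec S) (g : S ⟶ G.X),
    EtSheaf.ap map (Q.bundle.smul q g) = Q'.bundle.smul (EtSheaf.ap map q) g
  map_gsmul : ∀ {S : Sch k} (σ : Γ) (q : Q.bundle.sheaf.Sec S),
    EtSheaf.ap map (Q.bundle.gsmul σ q) = Q'.bundle.gsmul σ (EtSheaf.ap map q)

instance (P : GBundle ρ C) : Category (BunG P) where
  Hom := BunG.Hom
  id Q :=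
    { base := 𝟙 _
      map := 𝟙 _
      proj_map := fun q => by
        rw [MonoidalCategory.whiskerLeft_id]
        exact (Category.comp_id _).symm
      map_smul := fun _ _ => rfl
      map_gsmul := fun _ _ => rfl }
  comp {Q Q' Q''} u v :=
    { base := u.base ≫ v.base
      map := u.map ≫ v.map
      proj_map := fun q => by
        change Q''.bundle.proj (EtSheaf.ap v.map (EtSheaf.ap u.map q)) = _
        rw [v.proj_map, u.proj_map, MonoidalCategory.whiskerLeft_comp]
        exact Category.assoc _ _ _
      map_smul := fun q g => by
        change EtSheaf.ap v.map (EtSheaf.ap u.map _) = _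
        rw [u.map_smul, v.map_smul]
        rfl
      map_gsmul := fun σ q => by
        change EtSheaf.ap v.map (EtSheaf.ap u.map _) = _
        rw [u.map_gsmul, v.map_gsmul]
        rfl }
  id_comp _ := BunG.Hom.ext (Category.id_comp _) (Category.id_comp _)
  comp_id _ := BunG.Hom.ext (Category.comp_id _) (Category.comp_id _)
  assoc _ _ _ := BunG.Hom.ext (Category.assoc _ _ _) (Category.assoc _ _ _)

/-- The map on pairs `(f, p) ↦ (u f, p)` induced by a morphism `u` of `H_P`-bundles. -/
def BunH.Hom.pairMap {P : GBundle ρ C} {F F' : BunH P} (u : BunH.Hom F F') {S : Sch k}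
    (x : F.bundle.Pair S) : F'.bundle.Pair S :=
  F'.bundle.pair (EtSheaf.ap u.map x.1.1) x.1.2
    (by rw [u.proj_map, Category.assoc, whiskerLeft_fst, x.2])

/-- The stack `Bun^P_{(Γ,G)}` of `(Γ, G)`-bundles with the same local type as `P`, as a category
over the category of `k`-schemes. -/
def bunG (P : GBundle ρ C) : BasedCategory (Sch k) where
  obj := BunG P
  p :=
    { obj := fun Q => Q.T
      map := fun u => BunG.Hom.base u }

/-- The isomorphism of étale sheaves `e` identifies the contracted product
`π^* F ×^{π^* H_P} P`, with the structure induced by that of `P`, with the `(Γ, G)`-bundle `Q`: the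
class `[f, p]` lies over the image of `p` in `X̃` and the image of `f` in `T`, and
`[f, p] g = [f, p g]`, `σ [f, p] = [f, σ p]`.

(Locally, every point of the contracted product is of the form `[f, p]`.) -/
structure IsContractedProduct {P : GBundle ρ C} (F : BunH P) (Q : BunG P) (hT : Q.T = F.T)
    (e : F.bundle.contractedProduct ≅ Q.bundle.sheaf) : Prop where
  proj_total : ∀ {S : Sch k} (x : F.bundle.Pair S),
    Q.bundle.proj (EtSheaf.ap e.hom (F.bundle.cls x)) ≫ fst C.total Q.T = P.proj x.1.2
  proj_T : ∀ {S : Sch k} (x : F.bundle.Pair S),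
    Q.bundle.proj (EtSheaf.ap e.hom (F.bundle.cls x)) ≫ snd C.total Q.T ≫ eqToHom hT =
      F.bundle.proj x.1.1 ≫ snd C.base F.T
  smul : ∀ {S : Sch k} (x : F.bundle.Pair S) (g : S ⟶ G.X),
    Q.bundle.smul (EtSheaf.ap e.hom (F.bundle.cls x)) g =
      EtSheaf.ap e.hom (F.bundle.cls (x.smul g))
  gsmul : ∀ {S : Sch k} (σ : Γ) (x : F.bundle.Pair S),
    Q.bundle.gsmul σ (EtSheaf.ap e.hom (F.bundle.cls x)) =
      EtSheaf.ap e.hom (F.bundle.cls (x.gsmul σ))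

end Bundles
end GammaBundle

end

noncomputable section

namespace GammaBundle

/-! ### Gluing for the étale topology, and geometric points -/

section Sheaves

variable {k : Type u} [Field k]

/-! Étale-locally on `X × T` the torsor `F` has a point `f`, and `p ↦ [f, p]` then identifies the
pullback of `P` with the contracted product. The structure of `P` passes to classes `[f, p]` because
a point of `H_P` is by definition a bundle automorphism of `P` over `X̃` commuting with `G`
(`HP.smul_smul`) and with `Γ` (`HP.smul_gsmul`).

The technical point is to control the sheaf quotient. Since `H_P` is a group, `∼` is an equivalence
relation. Since `F` is a torsor, a class of pairs has exactly one representative `(f, p)` for each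
`f` in the relevant fibre of `F`. Hence `∼` can be checked étale-locally (`rel_of_cover`), so the
presheaf quotient is separated and `[x] = [y]` holds in its sheafification exactly when `x ∼ y`
(`cls_eq_iff`). As every point is locally a class, maps out of the quotient are constructed by
descent from pairs (`exists_desc`), and identities are checked on pairs (`sec_ext`, `hom_ext`).
Simple transitivity of `G` is inherited from `P` once two pairs are given the same first component.

For the local type, an étale covering of the spectrum of an algebraically closed field splits. So
`F` has a point `f` over each geometric point of `X × T`, and `p ↦ [f, p]` is an isomorphism there.
It is `Γ`-invariant because `Γ` leaves `f` alone.

A morphism `u` acts by `[f, p] ↦ [u(f), p]`. Cartesian morphisms are preserved because every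
morphism of `(Γ, G)`-bundles is strongly Cartesian: an equivariant map between fibres of `G`-torsors
is bijective (`existsUnique_of_equivariant`), so factorizations exist and are unique point by point.
-/

/-- Sections of an étale sheaf which agree on a covering sieve are equal. -/
lemma EtSheaf.ext_of_cover (F : EtSheaf k) {S : Sch k} {R : Sieve S} (hR : R ∈ etaleSite k S)
    {x y : F.Sec S} (h : ∀ {S' : Sch k} (a : S' ⟶ S), R.arrows a → F.res a x = F.res a y) :
    x = y :=
  (((isSheaf_iff_isSheaf_of_type _ _).1 F.property).isSeparated R hR).ext
    fun _ a ha => h a ha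

/-- Morphisms of `k`-schemes which agree on an étale covering sieve are equal. -/
lemma hom_ext_of_cover {S T : Sch k} {R : Sieve S} (hR : R ∈ etaleSite k S)
    {x y : S ⟶ T} (h : ∀ {S' : Sch k} (a : S' ⟶ S), R.arrows a → a ≫ x = a ≫ y) :
    x = y :=
  ((GrothendieckTopology.Subcanonical.isSheaf_of_isRepresentable
    (J := etaleSite k) (yoneda.obj T)).isSeparated R hR).ext fun _ a ha => h a ha

/-- A property of sections which is stable under restriction, and which holds for at most one
section over each object and locally for some section, holds locally for a global section. -/
lemma exists_section_of_local {F : (Sch k)ᵒᵖ ⥤ Type*} (hF : Presieve.IsSheaf (etaleSite k) F)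
    {S : Sch k} (p : ∀ {S' : Sch k}, (S' ⟶ S) → F.obj (op S') → Prop)
    (hres : ∀ {S' S'' : Sch k} (b : S'' ⟶ S') (a : S' ⟶ S) (x : F.obj (op S')), p a x →
      p (b ≫ a) (F.map b.op x))
    (huniq : ∀ {S' : Sch k} (a : S' ⟶ S) (x y : F.obj (op S')), p a x → p a y → x = y)
    {R : Sieve S} (hR : R ∈ etaleSite k S)
    (hex : ∀ {S' : Sch k} (a : S' ⟶ S), R.arrows a → ∃ x, p a x) :
    ∃ x : F.obj (op S), ∀ {S' : Sch k} (a : S' ⟶ S), R.arrows a → p a (F.map a.op x) := by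
  choose s hs using @hex
  obtain ⟨x, hx, -⟩ := hF R hR (fun S' a ha => s a ha) (by
    intro Y₁ Y₂ Z g₁ g₂ f₁ f₂ k₁ k₂ e
    -- Uniqueness over the overlap makes the chosen local sections compatible.
    refine huniq (g₁ ≫ f₁) _ _ (hres _ _ _ (hs _ k₁)) ?_
    rw [e]
    exact hres _ _ _ (hs _ k₂))
  refine ⟨x, fun {S'} a ha => ?_⟩
  rw [hx a ha]
  exact hs a ha

/-- `exists_section_of_local` for étale sheaves. -/
lemma EtSheaf.exists_of_local (F : EtSheaf k)
    {S : Sch k} (p : ∀ {S' : Sch k}, (S' ⟶ S) → F.Sec S' → Prop)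
    (hres : ∀ {S' S'' : Sch k} (b : S'' ⟶ S') (a : S' ⟶ S) (x : F.Sec S'), p a x →
      p (b ≫ a) (F.res b x))
    (huniq : ∀ {S' : Sch k} (a : S' ⟶ S) (x y : F.Sec S'), p a x → p a y → x = y)
    {R : Sieve S} (hR : R ∈ etaleSite k S)
    (hex : ∀ {S' : Sch k} (a : S' ⟶ S), R.arrows a → ∃ x, p a x) :
    ∃ x : F.Sec S, ∀ {S' : Sch k} (a : S' ⟶ S), R.arrows a → p a (F.res a x) :=
  exists_section_of_local ((isSheaf_iff_isSheaf_of_type _ _).1 F.property) p hres huniq hR hex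

/-- `exists_section_of_local` for the étale sheaf represented by a `k`-scheme. -/
lemma exists_hom_of_local {S T : Sch k} (p : ∀ {S' : Sch k}, (S' ⟶ S) → (S' ⟶ T) → Prop)
    (hres : ∀ {S' S'' : Sch k} (b : S'' ⟶ S') (a : S' ⟶ S) (x : S' ⟶ T), p a x →
      p (b ≫ a) (b ≫ x))
    (huniq : ∀ {S' : Sch k} (a : S' ⟶ S) (x y : S' ⟶ T), p a x → p a y → x = y)
    {R : Sieve S} (hR : R ∈ etaleSite k S)
    (hex : ∀ {S' : Sch k} (a : S' ⟶ S), R.arrows a → ∃ x, p a x) :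
    ∃ x : S ⟶ T, ∀ {S' : Sch k} (a : S' ⟶ S), R.arrows a → p a (a ≫ x) :=
  exists_section_of_local (GrothendieckTopology.Subcanonical.isSheaf_of_isRepresentable
    (J := etaleSite k) (yoneda.obj T)) p hres huniq hR hex

/-- An étale covering of the spectrum of an algebraically closed field has a section. -/
lemma top_of_mem_etaleSite_of_isAlgClosed {Ω : Type u} [Field Ω] [IsAlgClosed Ω]
    (f : Spec (CommRingCat.of Ω) ⟶ Spec (CommRingCat.of k)) {R : Sieve (Over.mk f)}
    (hR : R ∈ etaleSite k (Over.mk f)) : R.arrows (𝟙 (Over.mk f)) := by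
  -- The functor of `Ω`-points is a point of the étale site, so the identity of `Spec Ω` factors
  -- through some member of the covering.
  obtain ⟨Y, g, hg, y, hy⟩ := (Scheme.geometricFiber Ω).jointly_surjective _
    ((GrothendieckTopology.mem_over_iff _ _).1 hR) (𝟙 _)
  have hy' : y ≫ g = 𝟙 (Spec (CommRingCat.of Ω)) := hy
  have h := (Sieve.overEquiv (Over.mk f) R).downward_closed hg y
  rw [hy', Sieve.overEquiv_iff] at h
  have := R.downward_closed h (Over.homMk (𝟙 _) : Over.mk f ⟶ _)
  convert this
  ext1
  exact (Category.comp_id _).symm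

end Sheaves

section Bundles

variable {k : Type u} [Field k] {Γ : Type v} [Group Γ]
variable {G : Grp (Sch k)} {ρ : Γ →* Aut G} {C : EquivMap k Γ}

/-! ### The action of `H_P` on `P` -/

namespace HP

variable {P : GBundle ρ C} {S : Sch k} {s : S ⟶ C.base}

/-- Handles the dependence of fibres on the base point. The equality `y = y'` need not be assumed,
since it follows from `q.1 = q'.1` by projecting. -/
lemma toEquiv_val_congr (φ : HP P s) {S' : Sch k} {a a' : S' ⟶ S} {y y' : S' ⟶ C.total}
    (e : a ≫ s = y ≫ C.map) (e' : a' ≫ s = y' ≫ C.map) (q : P.Fib y) (q' : P.Fib y')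
    (ha : a = a') (hq : q.1 = q'.1) :
    (φ.1.toEquiv a y e q).1 = (φ.1.toEquiv a' y' e' q').1 := by
  subst ha
  obtain rfl : y = y' := by rw [← q.2, ← q'.2, hq]
  obtain rfl : q = q' := Subtype.ext hq
  rfl

lemma mul_smul (φ ψ : HP P s) (p : P.sheaf.Sec S) (h : P.proj p ≫ C.map = s)
    (h' : P.proj (ψ.smul p h) ≫ C.map = s) :
    (φ * ψ).smul p h = φ.smul (ψ.smul p h) h' :=
  toEquiv_val_congr φ (by rw [Category.id_comp, h]) _
    (ψ.1.toEquiv (𝟙 S) (P.proj p) (by rw [Category.id_comp, h]) ⟨p, rfl⟩) _ rfl rfl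

lemma one_smul (p : P.sheaf.Sec S) (h : P.proj p ≫ C.map = s) : (1 : HP P s).smul p h = p := rfl

lemma smul_smul (φ : HP P s) (p : P.sheaf.Sec S) (g : S ⟶ G.X) (h : P.proj p ≫ C.map = s)
    (h' : P.proj (P.smul p g) ≫ C.map = s) :
    φ.smul (P.smul p g) h' = P.smul (φ.smul p h) g :=
  (toEquiv_val_congr φ (by rw [Category.id_comp, h']) (by rw [Category.id_comp, h]) ⟨P.smul p g, rfl⟩
    (GBundle.Fib.smul ⟨p, rfl⟩ g) rfl rfl).trans
    (congrArg Subtype.val (φ.1.equivariant (𝟙 S) (P.proj p) (by rw [Category.id_comp, h])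
      ⟨p, rfl⟩ g))

/-- This is the invariance condition in the definition of `H_P`; it is what lets the action of `Γ`
descend from pairs to classes. -/
lemma smul_gsmul (φ : HP P s) (σ : Γ) (p : P.sheaf.Sec S) (h : P.proj p ≫ C.map = s)
    (h' : P.proj (P.gsmul σ p) ≫ C.map = s) :
    φ.smul (P.gsmul σ p) h' = P.gsmul σ (φ.smul p h) :=
  (toEquiv_val_congr φ (by rw [Category.id_comp, h'])
    (by rw [Category.id_comp, Category.assoc, C.act_map, h]) ⟨P.gsmul σ p, rfl⟩
    (GBundle.Fib.gsmul σ ⟨p, rfl⟩) rfl rfl).trans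
    (congrArg Subtype.val (φ.2 σ (𝟙 S) (P.proj p) (by rw [Category.id_comp, h])
      (by rw [Category.id_comp, Category.assoc, C.act_map, h]) ⟨p, rfl⟩))

end HP

/-! ### Equivalence of pairs -/

namespace HBundle

variable {P : GBundle ρ C} {T : Sch k} {F : HBundle P T} {S : Sch k}

/-- Frees the relation from the syntactic shape of its constructor, so that it applies to arbitrary
pairs. -/
lemma rel_iff {x y : F.Pair S} : F.Rel x y ↔ ∃ (s : S ⟶ C.base) (h : HP P s)
    (e : F.proj y.1.1 ≫ fst C.base T = s) (e' : P.proj x.1.2 ≫ C.map = s),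
    F.act y.1.1 h e = x.1.1 ∧ h.smul x.1.2 e' = y.1.2 := by
  constructor
  · rintro ⟨h, f, p, hf, hp⟩
    exact ⟨_, h, hf, hp, rfl, rfl⟩
  · obtain ⟨⟨f', p⟩, hx⟩ := x
    obtain ⟨⟨f, p'⟩, hy⟩ := y
    rintro ⟨s, h, e, e', h1, h2⟩
    dsimp only at e e' h1 h2
    subst h1 h2
    exact Rel.mk h f p e e'

lemma Rel.proj_left {x y : F.Pair S} (h : F.Rel x y) : F.proj x.1.1 = F.proj y.1.1 := by
  obtain ⟨s, h, e, e', h1, h2⟩ := rel_iff.1 h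
  rw [← h1, F.proj_act]

lemma Rel.proj_right {x y : F.Pair S} (h : F.Rel x y) : P.proj x.1.2 = P.proj y.1.2 := by
  obtain ⟨s, h, e, e', h1, h2⟩ := rel_iff.1 h
  rw [← h2, h.proj_smul]

lemma rel_refl (x : F.Pair S) : F.Rel x x :=
  rel_iff.2 ⟨_, 1, x.2, rfl, F.act_one _ _, HP.one_smul _ _⟩

lemma Rel.symm {x y : F.Pair S} (hxy : F.Rel x y) : F.Rel y x := by
  obtain ⟨⟨f', p⟩, hx⟩ := x
  obtain ⟨⟨f, p'⟩, hy⟩ := y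
  obtain ⟨s, h, e, e', h1, h2⟩ := rel_iff.1 hxy
  dsimp only at e e' h1 h2
  subst h1 h2
  have e1 : F.proj (F.act f h e) ≫ fst C.base T = s := by rw [F.proj_act, e]
  have e2 : P.proj (h.smul p e') ≫ C.map = s := by rw [h.proj_smul, e']
  refine rel_iff.2 ⟨s, h⁻¹, e1, e2, ?_, ?_⟩
  · dsimp only
    rw [← F.act_mul, mul_inv_cancel, F.act_one]
  · dsimp only
    rw [← HP.mul_smul, inv_mul_cancel, HP.one_smul]

lemma Rel.trans {x y z : F.Pair S} (hxy : F.Rel x y) (hyz : F.Rel y z) : F.Rel x z := by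
  have h0 := hxy.proj_left
  obtain ⟨s, h, e, e', h1, h2⟩ := rel_iff.1 hxy
  obtain ⟨s', h', e₁, e₁', h1', h2'⟩ := rel_iff.1 hyz
  -- Related pairs have the same image in `X`, so the two group elements live over the same point
  -- and can be multiplied.
  have e0 := e
  rw [hyz.proj_left, e₁] at e0
  subst e0
  refine rel_iff.2 ⟨s', h' * h, e₁, e', ?_, ?_⟩
  · rw [F.act_mul _ _ _ _ (by rw [F.proj_act, e₁]), ← h1]
    congr 1
  · rw [HP.mul_smul _ _ _ _ (by rw [HP.proj_smul, e']), ← h2']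
    congr 1

/-- `Quot` identifies points along the generated equivalence relation, which adds nothing here. -/
lemma eqvGen_rel_iff {x y : F.Pair S} : Relation.EqvGen F.Rel x y ↔ F.Rel x y :=
  ⟨fun h => by
    induction h with
    | rel _ _ h => exact h
    | refl => exact rel_refl _
    | symm _ _ _ h => exact h.symm
    | trans _ _ _ _ _ h h' => exact h.trans h', Relation.EqvGen.rel _ _⟩

lemma act_injective {s : S ⟶ C.base} (f : F.sheaf.Sec S) (h h' : HP P s)
    (e : F.proj f ≫ fst C.base T = s) (e' : F.act f h e = F.act f h' e) : h = h' := by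
  subst e
  exact (F.simply_transitive f (F.act f h' rfl) (F.proj_act _ _ _).symm).unique e' rfl

/-- Two equivalent pairs with the same first component are equal. -/
lemma Rel.eq_of_left_eq {x y : F.Pair S} (hxy : F.Rel x y) (e₀ : x.1.1 = y.1.1) : x = y := by
  obtain ⟨s, h, e, e', h1, h2⟩ := rel_iff.1 hxy
  obtain rfl : h = 1 := act_injective _ _ _ e (by rw [h1, e₀, F.act_one])
  exact Subtype.ext (Prod.ext e₀ h2)

/-- A pair is equivalent to a pair with any given first component in the same fibre. -/
lemma exists_rel_left_eq (x : F.Pair S) (f : F.sheaf.Sec S) (hf : F.proj x.1.1 = F.proj f) :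
    ∃ y : F.Pair S, F.Rel x y ∧ y.1.1 = f := by
  obtain ⟨h, hh, -⟩ := F.simply_transitive f x.1.1 hf.symm
  have e : P.proj x.1.2 ≫ C.map = F.proj f ≫ fst C.base T := by rw [← hf, x.2]
  exact ⟨F.pair f (h.smul x.1.2 e) (by rw [HP.proj_smul, e]),
    rel_iff.2 ⟨_, h, rfl, e, hh, rfl⟩, rfl⟩

lemma Pair.ext_of_cover {R : Sieve S} (hR : R ∈ etaleSite k S)
    {x y : F.Pair S} (h : ∀ {S' : Sch k} (a : S' ⟶ S), R.arrows a → x.res a = y.res a) :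
    x = y :=
  Subtype.ext (Prod.ext
    (F.sheaf.ext_of_cover hR fun a ha => congrArg (fun z : F.Pair _ => z.1.1) (h a ha))
    (P.sheaf.ext_of_cover hR fun a ha => congrArg (fun z : F.Pair _ => z.1.2) (h a ha)))

/-- The equivalence of pairs is local for the étale topology. -/
lemma rel_of_cover {R : Sieve S} (hR : R ∈ etaleSite k S) {x y : F.Pair S}
    (h : ∀ {S' : Sch k} (a : S' ⟶ S), R.arrows a → F.Rel (x.res a) (y.res a)) : F.Rel x y := by
  have hf : F.proj x.1.1 = F.proj y.1.1 := hom_ext_of_cover hR fun a ha => by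
    rw [← F.proj_res, ← F.proj_res]
    exact (h a ha).proj_left
  -- Replace `x` by the equivalent pair `z` with the same first component as `y`. Locally `z` and
  -- `y` are equivalent, hence equal because `H_P` acts freely on `F`; equality of pairs is local.
  obtain ⟨z, hz, hz'⟩ := exists_rel_left_eq x _ hf
  obtain rfl : z = y := Pair.ext_of_cover hR fun a ha =>
    ((hz.res a).symm.trans (h a ha)).eq_of_left_eq (congrArg (F.sheaf.res a) hz')
  exact hz

lemma Rel.smul {x y : F.Pair S} (hxy : F.Rel x y) (g : S ⟶ G.X) :
    F.Rel (x.smul g) (y.smul g) := by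
  obtain ⟨s, h, e, e', h1, h2⟩ := rel_iff.1 hxy
  refine rel_iff.2 ⟨s, h, e, (by rw [← e']; exact congrArg (· ≫ C.map) (P.proj_smul _ _)), h1, ?_⟩
  exact (HP.smul_smul _ _ _ e' _).trans (congrArg (P.smul · g) h2)

lemma Rel.gsmul {x y : F.Pair S} (hxy : F.Rel x y) (σ : Γ) :
    F.Rel (x.gsmul σ) (y.gsmul σ) := by
  obtain ⟨s, h, e, e', h1, h2⟩ := rel_iff.1 hxy
  refine rel_iff.2 ⟨s, h, e, ?_, h1, ?_⟩
  · refine (congrArg (· ≫ C.map) (P.proj_gsmul σ x.1.2)).trans ?_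
    rw [Category.assoc, C.act_map, e']
  · exact (HP.smul_gsmul _ _ _ e' _).trans (congrArg (P.gsmul σ ·) h2)

lemma Pair.res_smul {S' : Sch k} (a : S' ⟶ S) (x : F.Pair S) (g : S ⟶ G.X) :
    (x.smul g).res a = (x.res a).smul (a ≫ g) :=
  Subtype.ext (Prod.ext rfl (P.smul_res _ _ _))

lemma Pair.res_gsmul {S' : Sch k} (a : S' ⟶ S) (x : F.Pair S) (σ : Γ) :
    (x.gsmul σ).res a = (x.res a).gsmul σ :=
  Subtype.ext (Prod.ext rfl (P.gsmul_res _ _ _))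

/-! ### Points of the contracted product -/

lemma res_cls {S' : Sch k} (a : S' ⟶ S) (x : F.Pair S) :
    F.contractedProduct.res a (F.cls x) = F.cls (x.res a) :=
  (NatTrans.naturality_apply (toSheafify (etaleSite k) F.quotientPresheaf) a.op
    (Quot.mk _ x)).symm

lemma Rel.cls_eq {x y : F.Pair S} (h : F.Rel x y) : F.cls x = F.cls y :=
  congrArg (fun q => (toSheafify (etaleSite k) F.quotientPresheaf).app (op S) q) (Quot.sound h)

/-- Points of a presheaf with the same image in the sheafification agree on a covering, and the
relation is local. -/
lemma cls_eq_iff {x y : F.Pair S} : F.cls x = F.cls y ↔ F.Rel x y := by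
  refine ⟨fun h => ?_, Rel.cls_eq⟩
  have := Presheaf.equalizerSieve_mem (etaleSite k)
    (toSheafify (etaleSite k) F.quotientPresheaf) (X := op S) (Quot.mk _ x) (Quot.mk _ y) h
  exact rel_of_cover this fun a ha => eqvGen_rel_iff.1 (Quot.eqvGen_exact ha)

/-- Locally, every point of the contracted product is the class of a pair. -/
lemma exists_cls (q : F.contractedProduct.Sec S) : ∃ R ∈ etaleSite k S,
    ∀ {S' : Sch k} (a : S' ⟶ S), R.arrows a →
      ∃ x : F.Pair S', F.contractedProduct.res a q = F.cls x := by
  refine ⟨_, Presheaf.imageSieve_mem (etaleSite k)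
    (toSheafify (etaleSite k) F.quotientPresheaf) (U := op S) q, fun {S'} a ha => ?_⟩
  obtain ⟨⟨x⟩, hx⟩ := ha
  exact ⟨x, hx.symm⟩

/-- Descent from pairs to points of the contracted product. -/
lemma exists_desc {E : (Sch k)ᵒᵖ ⥤ Type*} (hE : Presieve.IsSheaf (etaleSite k) E)
    (q : F.contractedProduct.Sec S)
    (φ : ∀ {S' : Sch k}, (S' ⟶ S) → F.Pair S' → E.obj (op S'))
    (hres : ∀ {S' S'' : Sch k} (b : S'' ⟶ S') (a : S' ⟶ S) (x : F.Pair S'),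
      φ (b ≫ a) (x.res b) = E.map b.op (φ a x))
    (hrel : ∀ {S' : Sch k} (a : S' ⟶ S) (x y : F.Pair S'), F.Rel x y → φ a x = φ a y) :
    ∃ e : E.obj (op S), ∀ {S' : Sch k} (a : S' ⟶ S) (x : F.Pair S'),
      F.contractedProduct.res a q = F.cls x → E.map a.op e = φ a x := by
  obtain ⟨R, hR, hq⟩ := exists_cls q
  -- Glue the values `φ a x` over all pairs representing `q` locally. Two representatives are
  -- related by `cls_eq_iff`, so `hrel` makes the value unique.
  obtain ⟨e, he⟩ := exists_section_of_local hE
    (fun {S'} a e => ∃ x : F.Pair S', F.contractedProduct.res a q = F.cls x ∧ e = φ a x)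
    (by
      rintro S' S'' b a _ ⟨x, hx, rfl⟩
      exact ⟨x.res b, by rw [EtSheaf.res_comp, hx, res_cls], (hres _ _ _).symm⟩)
    (by
      rintro S' a _ _ ⟨x, hx, rfl⟩ ⟨y, hy, rfl⟩
      exact hrel _ _ _ (cls_eq_iff.1 (hx.symm.trans hy)))
    hR (fun a ha => (hq a ha).imp' (φ a) fun x hx => ⟨x, hx, rfl⟩)
  refine ⟨e, fun {S'} a x hx => ?_⟩
  -- Here `a` need not belong to the covering `R`, so the equality is checked on the pullback of `R`
  -- along `a`.
  refine ((hE.isSeparated) _ ((etaleSite k).pullback_stable a hR)).ext fun S'' b hb => ?_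
  obtain ⟨x', hx', h⟩ := he (b ≫ a) hb
  rw [← hres, ← hrel (b ≫ a) x' (x.res b) ?_, ← h]
  · simp
  · rw [← cls_eq_iff, ← res_cls, ← hx, ← hx', EtSheaf.res_comp]

lemma exists_hom_desc {Y : Sch k}
    (q : F.contractedProduct.Sec S)
    (φ : ∀ {S' : Sch k}, (S' ⟶ S) → F.Pair S' → (S' ⟶ Y))
    (hres : ∀ {S' S'' : Sch k} (b : S'' ⟶ S') (a : S' ⟶ S) (x : F.Pair S'),
      φ (b ≫ a) (x.res b) = b ≫ φ a x)
    (hrel : ∀ {S' : Sch k} (a : S' ⟶ S) (x y : F.Pair S'), F.Rel x y → φ a x = φ a y) :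
    ∃ e : S ⟶ Y, ∀ {S' : Sch k} (a : S' ⟶ S) (x : F.Pair S'),
      F.contractedProduct.res a q = F.cls x → a ≫ e = φ a x :=
  exists_desc (GrothendieckTopology.Subcanonical.isSheaf_of_isRepresentable
    (J := etaleSite k) (yoneda.obj Y)) q φ hres hrel

lemma exists_sec_desc (E : EtSheaf k)
    (q : F.contractedProduct.Sec S)
    (φ : ∀ {S' : Sch k}, (S' ⟶ S) → F.Pair S' → E.Sec S')
    (hres : ∀ {S' S'' : Sch k} (b : S'' ⟶ S') (a : S' ⟶ S) (x : F.Pair S'),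
      φ (b ≫ a) (x.res b) = E.res b (φ a x))
    (hrel : ∀ {S' : Sch k} (a : S' ⟶ S) (x y : F.Pair S'), F.Rel x y → φ a x = φ a y) :
    ∃ e : E.Sec S, ∀ {S' : Sch k} (a : S' ⟶ S) (x : F.Pair S'),
      F.contractedProduct.res a q = F.cls x → E.res a e = φ a x :=
  exists_desc ((isSheaf_iff_isSheaf_of_type _ _).1 E.property) q φ hres hrel

end HBundle

/-! ### Equivariant maps between torsors -/

namespace GBundle

lemma smul_left_cancel (Q : GBundle ρ C) {S : Sch k} (q : Q.sheaf.Sec S) {g g' : S ⟶ G.X}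
    (h : Q.smul q g = Q.smul q g') : g = g' :=
  (Q.simply_transitive q (Q.smul q g') (Q.proj_smul _ _).symm).unique h rfl

/-- A `G`-equivariant map from the fibre of a `G`-torsor at `y` to the fibre of a `G`-torsor
at `y'` is bijective. -/
lemma existsUnique_of_equivariant {C' : EquivMap k Γ} (Q : GBundle ρ C) (Q' : GBundle ρ C')
    {S : Sch k} (y : S ⟶ C.total) (y' : S ⟶ C'.total)
    (θ : ∀ {S' : Sch k} (b : S' ⟶ S) (q : Q.sheaf.Sec S'), Q.proj q = b ≫ y → Q'.sheaf.Sec S')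
    (hproj : ∀ {S' : Sch k} (b : S' ⟶ S) (q : Q.sheaf.Sec S') (h : Q.proj q = b ≫ y),
      Q'.proj (θ b q h) = b ≫ y')
    (hsmul : ∀ {S' : Sch k} (b : S' ⟶ S) (q : Q.sheaf.Sec S') (h : Q.proj q = b ≫ y)
      (g : S' ⟶ G.X) (h' : Q.proj (Q.smul q g) = b ≫ y),
      θ b (Q.smul q g) h' = Q'.smul (θ b q h) g)
    (hres : ∀ {S' S'' : Sch k} (c : S'' ⟶ S') (b : S' ⟶ S) (q : Q.sheaf.Sec S')
      (h : Q.proj q = b ≫ y) (h' : Q.proj (Q.sheaf.res c q) = (c ≫ b) ≫ y),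
      θ (c ≫ b) (Q.sheaf.res c q) h' = Q'.sheaf.res c (θ b q h))
    (q' : Q'.sheaf.Sec S) (hq' : Q'.proj q' = y') :
    ∃! q : Q.sheaf.Sec S, ∃ h : Q.proj q = 𝟙 S ≫ y, θ (𝟙 S) q h = q' := by
  -- Injectivity: two points of a fibre differ by some `g`, and `θ` turns this into an element of
  -- `G` fixing a point of `Q'`, so `g = 1`.
  have huniq : ∀ {S' : Sch k} (b : S' ⟶ S) (q₁ q₂ : Q.sheaf.Sec S') (h₁ : Q.proj q₁ = b ≫ y)
      (h₂ : Q.proj q₂ = b ≫ y), θ b q₁ h₁ = θ b q₂ h₂ → q₁ = q₂ := by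
    intro S' b q₁ q₂ h₁ h₂ e
    obtain ⟨g, rfl, -⟩ := Q.simply_transitive q₁ q₂ (h₁.trans h₂.symm)
    rw [hsmul b q₁ h₁ g] at e
    obtain rfl : (1 : S' ⟶ G.X) = g := Q'.smul_left_cancel _ ((Q'.smul_one _).trans e)
    exact (Q.smul_one _).symm
  obtain ⟨R, hR, hQ⟩ := Q.locally_nonempty y
  -- Surjectivity: locally take any point of the fibre and translate it by the element of `G` that
  -- carries its image to `q'`. By injectivity the results glue.
  obtain ⟨q, hq⟩ := Q.sheaf.exists_of_local
    (fun {S'} b q => ∃ h : Q.proj q = b ≫ y, θ b q h = Q'.sheaf.res b q')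
    (by
      rintro S' S'' c b q ⟨h, e⟩
      have h' : Q.proj (Q.sheaf.res c q) = (c ≫ b) ≫ y := by
        rw [Q.proj_res, h, Category.assoc]
      exact ⟨h', by rw [hres c b q h h', e, EtSheaf.res_comp]⟩)
    (by
      rintro S' b q₁ q₂ ⟨h₁, e₁⟩ ⟨h₂, e₂⟩
      exact huniq b q₁ q₂ h₁ h₂ (e₁.trans e₂.symm))
    hR (fun {S'} b hb => by
      obtain ⟨q, h⟩ := hQ b hb
      obtain ⟨g, hg, -⟩ := Q'.simply_transitive (θ b q h) (Q'.sheaf.res b q')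
        (by rw [hproj, Q'.proj_res, hq'])
      exact ⟨Q.smul q g, (Q.proj_smul _ _).trans h, (hsmul b q h g _).trans hg⟩)
  have h : Q.proj q = 𝟙 S ≫ y := by
    rw [Category.id_comp]
    refine hom_ext_of_cover hR fun a ha => ?_
    rw [← Q.proj_res, (hq a ha).1]
  have hθ : θ (𝟙 S) q h = q' := Q'.sheaf.ext_of_cover hR fun a ha => by
    obtain ⟨h', e⟩ := hq a ha
    rw [← hres a (𝟙 S) q h (by rw [Category.comp_id, h']), ← e]
    simp only [Category.comp_id]
  exact ⟨q, ⟨h, hθ⟩, fun q₂ ⟨h₂, e⟩ => huniq _ _ _ h₂ h (e.trans hθ.symm)⟩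

end GBundle

/-! ### The contracted product as a `(Γ, G)`-bundle -/

namespace HBundle

variable {P : GBundle ρ C} {T : Sch k} {F : HBundle P T} {S : Sch k}

/-- The point of `X̃ × T` under a pair `(f, p)`. -/
def Pair.proj (x : F.Pair S) : S ⟶ C.total ⊗ T :=
  lift (P.proj x.1.2) (F.proj x.1.1 ≫ snd C.base T)

lemma Pair.proj_res {S' : Sch k} (a : S' ⟶ S) (x : F.Pair S) : (x.res a).proj = a ≫ x.proj := by
  rw [Pair.proj, Pair.proj, comp_lift, ← Category.assoc, ← F.proj_res, ← P.proj_res]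
  rfl

lemma Rel.proj_eq {x y : F.Pair S} (h : F.Rel x y) : x.proj = y.proj := by
  rw [Pair.proj, Pair.proj, h.proj_left, h.proj_right]

lemma Pair.proj_smul (x : F.Pair S) (g : S ⟶ G.X) : (x.smul g).proj = x.proj :=
  congrArg (lift · (F.proj x.1.1 ≫ snd C.base T)) (P.proj_smul x.1.2 g)

lemma Pair.proj_gsmul (x : F.Pair S) (σ : Γ) :
    (x.gsmul σ).proj = x.proj ≫ (C.act σ).hom ▷ T := by
  refine (congrArg (lift · (F.proj x.1.1 ≫ snd C.base T)) (P.proj_gsmul σ x.1.2)).trans ?_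
  rw [Pair.proj, lift_whiskerRight]

/-- The equality of the points of `X̃ × T` under two pairs `(f, p)` and `(f', p')` implies that
`f` and `f'` lie in the same fibre. -/
lemma Pair.proj_left_eq {x y : F.Pair S} (h : x.proj = y.proj) : F.proj x.1.1 = F.proj y.1.1 := by
  have h1 : P.proj x.1.2 = P.proj y.1.2 := by simpa [Pair.proj] using congrArg (· ≫ fst _ _) h
  have h2 := congrArg (· ≫ snd _ _) h
  simp only [Pair.proj, lift_snd] at h2
  exact CartesianMonoidalCategory.hom_ext _ _ (by rw [x.2, y.2, h1]) h2

/-- Both pairs have the same first component, so they are equal, and `G` acts freely on `P`. -/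
lemma smul_injective (x : F.Pair S) {g g' : S ⟶ G.X} (h : F.Rel (x.smul g) (x.smul g')) :
    g = g' :=
  P.smul_left_cancel x.1.2 (congrArg (fun z : F.Pair S => z.1.2) (h.eq_of_left_eq rfl))

/-- Once `y` is moved to the first component of `x`, the second components lie in one fibre of `P`,
on which `G` is transitive. -/
lemma exists_rel_smul {x y : F.Pair S} (h : x.proj = y.proj) :
    ∃ g : S ⟶ G.X, F.Rel (x.smul g) y := by
  obtain ⟨z, hz, hz'⟩ := exists_rel_left_eq y x.1.1 (Pair.proj_left_eq h).symm
  have e : x.proj = z.proj := h.trans hz.proj_eq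
  have h1 : P.proj x.1.2 = P.proj z.1.2 := by simpa [Pair.proj] using congrArg (· ≫ fst _ _) e
  obtain ⟨g, hg, -⟩ := P.simply_transitive _ _ h1
  refine ⟨g, ?_⟩
  obtain rfl : x.smul g = z := Subtype.ext (Prod.ext hz'.symm hg)
  exact hz.symm

variable (F) in
/-- The projection of the contracted product to `X̃ × T`. -/
def cproj (q : F.contractedProduct.Sec S) : S ⟶ C.total ⊗ T :=
  (exists_hom_desc q (fun _ x => x.proj) (fun b _ x => Pair.proj_res b x)
    (fun _ _ _ h => h.proj_eq)).choose

/-- Characterizes the chosen projection by its value on every local representative of `q`. -/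
lemma comp_cproj (q : F.contractedProduct.Sec S) {S' : Sch k} (a : S' ⟶ S) (x : F.Pair S')
    (h : F.contractedProduct.res a q = F.cls x) : a ≫ F.cproj q = x.proj :=
  (exists_hom_desc q (fun _ x => x.proj) (fun b _ x => Pair.proj_res b x)
    (fun _ _ _ h => h.proj_eq)).choose_spec a x h

lemma cproj_cls (x : F.Pair S) : F.cproj (F.cls x) = x.proj :=
  (Category.id_comp _).symm.trans (comp_cproj (F.cls x) (𝟙 S) x (EtSheaf.res_id _ _))

lemma cproj_res {S' : Sch k} (a : S' ⟶ S) (q : F.contractedProduct.Sec S) :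
    F.cproj (F.contractedProduct.res a q) = a ≫ F.cproj q := by
  obtain ⟨R, hR, h⟩ := exists_cls (F.contractedProduct.res a q)
  refine hom_ext_of_cover hR fun b hb => ?_
  obtain ⟨x, hx⟩ := h b hb
  rw [comp_cproj _ b x hx, ← Category.assoc, comp_cproj _ (b ≫ a) x (by rw [EtSheaf.res_comp, hx])]

variable (F) in
/-- The right action of `G` on the contracted product. -/
def csmul (q : F.contractedProduct.Sec S) (g : S ⟶ G.X) : F.contractedProduct.Sec S :=
  (exists_sec_desc F.contractedProduct q (fun a x => F.cls (x.smul (a ≫ g)))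
    (fun b a x => by rw [res_cls, Pair.res_smul, Category.assoc])
    (fun _ _ _ h => (h.smul _).cls_eq)).choose

lemma res_csmul' (q : F.contractedProduct.Sec S) (g : S ⟶ G.X) {S' : Sch k} (a : S' ⟶ S)
    (x : F.Pair S') (h : F.contractedProduct.res a q = F.cls x) :
    F.contractedProduct.res a (F.csmul q g) = F.cls (x.smul (a ≫ g)) :=
  (exists_sec_desc F.contractedProduct q (fun a x => F.cls (x.smul (a ≫ g)))
    (fun b a x => by rw [res_cls, Pair.res_smul, Category.assoc])
    (fun _ _ _ h => (h.smul _).cls_eq)).choose_spec a x h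

lemma csmul_cls (x : F.Pair S) (g : S ⟶ G.X) : F.csmul (F.cls x) g = F.cls (x.smul g) := by
  have := res_csmul' (F.cls x) g (𝟙 S) x (EtSheaf.res_id _ _)
  rwa [EtSheaf.res_id, Category.id_comp] at this

lemma res_csmul {S' : Sch k} (a : S' ⟶ S) (q : F.contractedProduct.Sec S) (g : S ⟶ G.X) :
    F.contractedProduct.res a (F.csmul q g) = F.csmul (F.contractedProduct.res a q) (a ≫ g) := by
  obtain ⟨R, hR, h⟩ := exists_cls (F.contractedProduct.res a q)
  refine F.contractedProduct.ext_of_cover hR fun b hb => ?_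
  obtain ⟨x, hx⟩ := h b hb
  rw [res_csmul' _ _ b x hx, ← EtSheaf.res_comp, res_csmul' _ _ (b ≫ a) x
    (by rw [EtSheaf.res_comp, hx]), Category.assoc]

variable (F) in
/-- The left action of `Γ` on the contracted product. -/
def cgsmul (σ : Γ) (q : F.contractedProduct.Sec S) : F.contractedProduct.Sec S :=
  (exists_sec_desc F.contractedProduct q (fun _ x => F.cls (x.gsmul σ))
    (fun b a x => by rw [res_cls, Pair.res_gsmul])
    (fun _ _ _ h => (h.gsmul _).cls_eq)).choose

lemma res_cgsmul' (σ : Γ) (q : F.contractedProduct.Sec S) {S' : Sch k} (a : S' ⟶ S)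
    (x : F.Pair S') (h : F.contractedProduct.res a q = F.cls x) :
    F.contractedProduct.res a (F.cgsmul σ q) = F.cls (x.gsmul σ) :=
  (exists_sec_desc F.contractedProduct q (fun _ x => F.cls (x.gsmul σ))
    (fun b a x => by rw [res_cls, Pair.res_gsmul])
    (fun _ _ _ h => (h.gsmul _).cls_eq)).choose_spec a x h

lemma cgsmul_cls (σ : Γ) (x : F.Pair S) : F.cgsmul σ (F.cls x) = F.cls (x.gsmul σ) := by
  have := res_cgsmul' σ (F.cls x) (𝟙 S) x (EtSheaf.res_id _ _)
  rwa [EtSheaf.res_id] at this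

lemma res_cgsmul {S' : Sch k} (a : S' ⟶ S) (σ : Γ) (q : F.contractedProduct.Sec S) :
    F.contractedProduct.res a (F.cgsmul σ q) = F.cgsmul σ (F.contractedProduct.res a q) := by
  obtain ⟨R, hR, h⟩ := exists_cls (F.contractedProduct.res a q)
  refine F.contractedProduct.ext_of_cover hR fun b hb => ?_
  obtain ⟨x, hx⟩ := h b hb
  rw [res_cgsmul' _ _ b x hx, ← EtSheaf.res_comp, res_cgsmul' _ _ (b ≫ a) x
    (by rw [EtSheaf.res_comp, hx])]

/-- An equality of points of étale sheaves that depend on a point `q` of the contracted product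
may be checked after passing to a covering on which `q` is the class of a pair. -/
lemma sec_ext {E : EtSheaf k} {e e' : E.Sec S} (q : F.contractedProduct.Sec S)
    (h : ∀ {S' : Sch k} (a : S' ⟶ S) (x : F.Pair S'), F.contractedProduct.res a q = F.cls x →
      E.res a e = E.res a e') : e = e' := by
  obtain ⟨R, hR, hq⟩ := exists_cls q
  refine E.ext_of_cover hR fun a ha => ?_
  obtain ⟨x, hx⟩ := hq a ha
  exact h a x hx

/-- The analogue of `sec_ext` for morphisms to a `k`-scheme. -/
lemma hom_ext {Y : Sch k} {e e' : S ⟶ Y} (q : F.contractedProduct.Sec S)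
    (h : ∀ {S' : Sch k} (a : S' ⟶ S) (x : F.Pair S'), F.contractedProduct.res a q = F.cls x →
      a ≫ e = a ≫ e') : e = e' := by
  obtain ⟨R, hR, hq⟩ := exists_cls q
  refine hom_ext_of_cover hR fun a ha => ?_
  obtain ⟨x, hx⟩ := hq a ha
  exact h a x hx

lemma csmul_left_cancel (q : F.contractedProduct.Sec S) {g g' : S ⟶ G.X}
    (h : F.csmul q g = F.csmul q g') : g = g' :=
  hom_ext q fun a x hx => smul_injective x <| cls_eq_iff.1 <| by
    rw [← res_csmul' q g a x hx, ← res_csmul' q g' a x hx, h]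

lemma exists_csmul_eq (q q' : F.contractedProduct.Sec S) (h : F.cproj q = F.cproj q') :
    ∃ g, F.csmul q g = q' := by
  obtain ⟨R, hR, hq⟩ := exists_cls q
  obtain ⟨R', hR', hq'⟩ := exists_cls q'
  have hRR := (etaleSite k).intersection_covering hR hR'
  -- Where both points are classes of pairs a suitable `g` exists; it is unique by cancellation, so
  -- the local choices glue.
  obtain ⟨g, hg⟩ := exists_hom_of_local
    (fun {S'} a g => F.csmul (F.contractedProduct.res a q) g = F.contractedProduct.res a q')
    (by
      intro S' S'' b a g e
      rw [EtSheaf.res_comp, ← res_csmul, e, EtSheaf.res_comp])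
    (fun a g g' e e' => csmul_left_cancel _ (e.trans e'.symm)) hRR
    (by
      intro S' a ha
      obtain ⟨x, hx⟩ := hq a ha.1
      obtain ⟨y, hy⟩ := hq' a ha.2
      obtain ⟨g, hg⟩ := exists_rel_smul (x := x) (y := y)
        (by rw [← comp_cproj q a x hx, ← comp_cproj q' a y hy, h])
      exact ⟨g, by rw [hx, hy, csmul_cls, hg.cls_eq]⟩)
  refine ⟨g, F.contractedProduct.ext_of_cover hRR fun a ha => ?_⟩
  rw [res_csmul, hg a ha]

variable (F) in
/-- The contracted product `π^* F ×^{π^* H_P} P` as a `(Γ, G)`-bundle. -/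
def contractedBundle : GBundle ρ (C.prod T) where
  sheaf := F.contractedProduct
  proj q := F.cproj q
  proj_res a q := cproj_res a q
  smul q g := F.csmul q g
  smul_one q := sec_ext q fun a x hx => by
    rw [res_csmul' _ _ a x hx, hx, MonObj.comp_one]
    exact congrArg F.cls (Subtype.ext (Prod.ext rfl (P.smul_one _)))
  smul_mul q g g' := sec_ext q fun a x hx => by
    rw [res_csmul' _ _ a x hx, res_csmul, res_csmul' _ _ a x hx, csmul_cls, MonObj.comp_mul]
    exact congrArg F.cls (Subtype.ext (Prod.ext rfl (P.smul_mul _ _ _)))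
  smul_res a q g := res_csmul a q g
  proj_smul q g := hom_ext q fun a x hx => by
    refine (comp_cproj _ a _ (res_csmul' q g a x hx)).trans ?_
    rw [Pair.proj_smul]
    exact (comp_cproj q a x hx).symm
  simply_transitive q q' h := by
    obtain ⟨g, hg⟩ := exists_csmul_eq q q' h
    exact ⟨g, hg, fun g' hg' => csmul_left_cancel q (hg'.trans hg.symm)⟩
  locally_nonempty {S} y := by
    change S ⟶ C.total ⊗ T at y
    obtain ⟨R, hR, hP⟩ := P.locally_nonempty (y ≫ fst C.total T)
    obtain ⟨R', hR', hF⟩ := F.locally_nonempty (y ≫ C.map ▷ T)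
    -- On a common refinement, choose `p` over the `X̃`-component of `y` and `f` over the image of
    -- `y` in `X × T`.
    refine ⟨_, (etaleSite k).intersection_covering hR hR', fun {S'} a ha => ?_⟩
    obtain ⟨p, hp⟩ := hP a ha.1
    obtain ⟨f, hf⟩ := hF a ha.2
    refine ⟨F.cls (F.pair f p (by simp [hp, hf])), ?_⟩
    refine (cproj_cls _).trans ?_
    change lift (P.proj p) (F.proj f ≫ snd C.base T) = a ≫ y
    rw [hp, hf]
    apply CartesianMonoidalCategory.hom_ext <;> simp
  gsmul σ q := F.cgsmul σ q
  gsmul_one q := sec_ext q fun a x hx => by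
    rw [res_cgsmul' _ _ a x hx, hx]
    exact congrArg F.cls (Subtype.ext (Prod.ext rfl (P.gsmul_one _)))
  gsmul_mul σ τ q := sec_ext q fun a x hx => by
    rw [res_cgsmul' _ _ a x hx, res_cgsmul, res_cgsmul' _ _ a x hx, cgsmul_cls]
    exact congrArg F.cls (Subtype.ext (Prod.ext rfl (P.gsmul_mul _ _ _)))
  gsmul_res a σ q := res_cgsmul a σ q
  proj_gsmul σ q := hom_ext q fun a x hx => by
    refine (comp_cproj _ a _ (res_cgsmul' σ q a x hx)).trans ?_
    rw [Pair.proj_gsmul, ← comp_cproj q a x hx]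
    exact Category.assoc _ _ _
  gsmul_smul σ q g := sec_ext q fun a x hx => by
    rw [res_cgsmul' σ _ a _ (res_csmul' q g a x hx),
      res_csmul' _ _ a _ (res_cgsmul' σ q a x hx), ← Category.assoc]
    exact congrArg F.cls (Subtype.ext (Prod.ext rfl (P.gsmul_smul _ _ _)))

end HBundle

/-! ### Trivialization by a point of `F`, and the local type -/

namespace HBundle

variable {P : GBundle ρ C} {T : Sch k} {F : HBundle P T} {S : Sch k}

/-- The pair `(f, p)` obtained from a fixed point `f` of `F` and a point of a fibre of `P × T`. -/
def pairOfFib (f : F.sheaf.Sec S) {S' : Sch k} (a : S' ⟶ S) (y : S' ⟶ C.total ⊗ T)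
    (h : a ≫ F.proj f = y ≫ C.map ▷ T) (q : GBundle.Fib (P.prod T) y) : F.Pair S' :=
  F.pair (F.sheaf.res a f) q.1.1 (by
    have hq : lift (P.proj q.1.1) q.1.2 = y := q.2
    have hq' : P.proj q.1.1 = y ≫ fst C.total T := by simpa using congrArg (· ≫ fst C.total T) hq
    rw [F.proj_res, h, hq', Category.assoc, whiskerRight_fst, Category.assoc])

/-- The pair forgets the `T`-component of `q`; `h` recovers it from `f`. -/
lemma proj_pairOfFib (f : F.sheaf.Sec S) {S' : Sch k} (a : S' ⟶ S) (y : S' ⟶ C.total ⊗ T)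
    (h : a ≫ F.proj f = y ≫ C.map ▷ T) (q : GBundle.Fib (P.prod T) y) :
    (pairOfFib f a y h q).proj = y := by
  have hq : lift (P.proj q.1.1) q.1.2 = y := q.2
  have hq' : P.proj q.1.1 = y ≫ fst C.total T := by simpa using congrArg (· ≫ fst C.total T) hq
  change lift (P.proj q.1.1) (F.proj (F.sheaf.res a f) ≫ snd C.base T) = y
  rw [F.proj_res, h, hq', Category.assoc, whiskerRight_snd]
  apply CartesianMonoidalCategory.hom_ext <;> simp

/-- The map `p ↦ [f, p]` on fibres. -/
def fibMap (f : F.sheaf.Sec S) {S' : Sch k} (a : S' ⟶ S) (y : S' ⟶ C.total ⊗ T)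
    (h : a ≫ F.proj f = y ≫ C.map ▷ T) (q : GBundle.Fib (P.prod T) y) :
    GBundle.Fib F.contractedBundle y :=
  ⟨F.cls (pairOfFib f a y h q), (cproj_cls _).trans (proj_pairOfFib f a y h q)⟩

/-- With `f` fixed, `p ↦ [f, p]` is a `G`-equivariant map between fibres of torsors. -/
lemma fibMap_bijective (f : F.sheaf.Sec S) {S' : Sch k} (a : S' ⟶ S) (y : S' ⟶ C.total ⊗ T)
    (h : a ≫ F.proj f = y ≫ C.map ▷ T) : Function.Bijective (fibMap f a y h) := by
  rw [Function.bijective_iff_existsUnique]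
  intro q'
  obtain ⟨q, ⟨hq, e⟩, hu⟩ := GBundle.existsUnique_of_equivariant (P.prod T) F.contractedBundle y y
    (fun b q hq => F.cls (pairOfFib f (b ≫ a) (b ≫ y) (by rw [Category.assoc, h, Category.assoc])
      ⟨q, hq⟩))
    (fun b q hq => (cproj_cls _).trans (proj_pairOfFib _ _ _ _ _))
    (fun b q hq g hq' => (csmul_cls (pairOfFib f (b ≫ a) (b ≫ y) _ ⟨q, hq⟩) g).symm)
    (fun c b q hq hq' => by
      refine Eq.trans ?_ (res_cls _ _).symm
      refine congrArg F.cls (Subtype.ext (Prod.ext ?_ rfl))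
      change F.sheaf.res ((c ≫ b) ≫ a) f = F.sheaf.res c (F.sheaf.res (b ≫ a) f)
      rw [← EtSheaf.res_comp, Category.assoc])
    q'.1 q'.2
  -- The torsor lemma speaks of points over `𝟙 S' ≫ y`; this removes the identities.
  have key : ∀ (q : GBundle.Fib (P.prod T) y) (hq : (P.prod T).proj q.1 = 𝟙 S' ≫ y),
      F.cls (pairOfFib f (𝟙 S' ≫ a) (𝟙 S' ≫ y) (by rw [Category.assoc, h, Category.assoc])
        ⟨q.1, hq⟩) = F.cls (pairOfFib f a y h q) := fun q hq => by
    refine congrArg F.cls (Subtype.ext (Prod.ext ?_ rfl))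
    exact congrArg (F.sheaf.res · f) (Category.id_comp a)
  refine ⟨⟨q, hq.trans (Category.id_comp y)⟩, Subtype.ext ((key ⟨q, _⟩ hq).symm.trans e), ?_⟩
  intro q₂ e₂
  refine Subtype.ext (hu q₂.1 ⟨q₂.2.trans (Category.id_comp y).symm, ?_⟩)
  exact (key q₂ _).trans (congrArg Subtype.val e₂)

/-- A point of `F` trivializes the contracted product, compatibly with the actions of `Γ`. -/
lemma sameLocalTypeAt_proj (f : F.sheaf.Sec S) :
    SameLocalTypeAt (P.prod T) F.contractedBundle (F.proj f) := by
  refine ⟨{ toEquiv := fun a y h => Equiv.ofBijective _ (fibMap_bijective f a y h)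
            natural := fun b a y h h' p => Subtype.ext ?_
            equivariant := fun a y h p g =>
              Subtype.ext (csmul_cls (pairOfFib f a y h p) g).symm },
    fun σ S' a y h h' p => Subtype.ext (cgsmul_cls σ (pairOfFib f a y h p)).symm⟩
  refine Eq.trans ?_ (res_cls b (pairOfFib f a y h p)).symm
  exact congrArg F.cls (Subtype.ext (Prod.ext (EtSheaf.res_comp _ _ _ _) rfl))

variable (F) in
lemma sameLocalType_contractedBundle : SameLocalType (P.prod T) F.contractedBundle := by
  intro Ω _ _ x
  obtain ⟨R, hR, hF⟩ := F.locally_nonempty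
    (Over.homMk (U := Over.mk (x ≫ (C.prod T).base.hom)) (V := (C.prod T).base) x)
  obtain ⟨f, hf⟩ := hF _ (top_of_mem_etaleSite_of_isAlgClosed _ hR)
  exact hf.trans (Category.id_comp _) ▸ sameLocalTypeAt_proj f

/-- Morphisms out of the contracted product are determined by their values on classes. -/
lemma contractedProduct_hom_ext {E : EtSheaf k} {u u' : F.contractedProduct ⟶ E}
    (h : ∀ {S : Sch k} (x : F.Pair S), EtSheaf.ap u (F.cls x) = EtSheaf.ap u' (F.cls x)) :
    u = u' := by
  apply Sheaf.hom_ext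
  ext S q
  change EtSheaf.ap u (S := S.unop) q = EtSheaf.ap u' (S := S.unop) q
  exact sec_ext (F := F) q fun a x hx => by rw [← EtSheaf.ap_res, ← EtSheaf.ap_res, hx, h]

end HBundle

/-! ### Functoriality of the contracted product -/

namespace BunH

variable {P : GBundle ρ C}

/-- The same point of `H_P` witnesses the relation, because `u` is `H_P`-equivariant and leaves `p`
unchanged. -/
lemma Hom.pairMap_rel {F F' : BunH P} (u : Hom F F') {S : Sch k} {x y : F.bundle.Pair S}
    (hxy : F.bundle.Rel x y) : F'.bundle.Rel (u.pairMap x) (u.pairMap y) := by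
  obtain ⟨s, h, e, e', h1, h2⟩ := HBundle.rel_iff.1 hxy
  have e1 : F'.bundle.proj (EtSheaf.ap u.map y.1.1) ≫ fst C.base F'.T = s := by
    rw [u.proj_map, Category.assoc, whiskerLeft_fst, e]
  refine HBundle.rel_iff.2 ⟨s, h, e1, e', ?_, h2⟩
  exact (u.map_act _ h e e1).symm.trans (congrArg (EtSheaf.ap u.map) h1)

lemma Hom.res_pairMap {F F' : BunH P} (u : Hom F F') {S S' : Sch k} (a : S' ⟶ S)
    (x : F.bundle.Pair S) : (u.pairMap x).res a = u.pairMap (x.res a) :=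
  Subtype.ext (Prod.ext (EtSheaf.ap_res u.map a x.1.1).symm rfl)

lemma Hom.proj_pairMap {F F' : BunH P} (u : Hom F F') {S : Sch k}
    (x : F.bundle.Pair S) : (u.pairMap x).proj = x.proj ≫ C.total ◁ u.base := by
  change lift (P.proj x.1.2) (F'.bundle.proj (EtSheaf.ap u.map x.1.1) ≫ snd C.base F'.T) = _
  rw [u.proj_map, HBundle.Pair.proj, lift_whiskerLeft, Category.assoc, Category.assoc,
    whiskerLeft_snd]

/-- The morphism of presheaf quotients induced by a morphism of `H_P`-bundles. -/
def Hom.quotientMap {F F' : BunH P} (u : Hom F F') :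
    F.bundle.quotientPresheaf ⟶ F'.bundle.quotientPresheaf where
  app S := ↾(Quot.map u.pairMap fun _ _ h => u.pairMap_rel h)
  naturality S S' a := by
    ext ⟨x⟩
    exact congrArg (Quot.mk _) (u.res_pairMap a.unop x).symm

/-- The morphism of contracted products induced by a morphism of `H_P`-bundles. -/
def Hom.contractedMap {F F' : BunH P} (u : Hom F F') :
    F.bundle.contractedProduct ⟶ F'.bundle.contractedProduct :=
  (presheafToSheaf (etaleSite k) _).map u.quotientMap

lemma Hom.contractedMap_cls {F F' : BunH P} (u : Hom F F') {S : Sch k} (x : F.bundle.Pair S) :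
    EtSheaf.ap u.contractedMap (F.bundle.cls x) = F'.bundle.cls (u.pairMap x) :=
  congrArg (fun w => w.app (op S) (Quot.mk _ x))
    (toSheafify_naturality (etaleSite k) u.quotientMap).symm

lemma Hom.res_contractedMap {F F' : BunH P} (u : Hom F F') {S S' : Sch k} (a : S' ⟶ S)
    (q : F.bundle.contractedProduct.Sec S) (x : F.bundle.Pair S')
    (hx : F.bundle.contractedProduct.res a q = F.bundle.cls x) :
    F'.bundle.contractedProduct.res a (EtSheaf.ap u.contractedMap q) =
      F'.bundle.cls (u.pairMap x) := by
  rw [← EtSheaf.ap_res, hx, u.contractedMap_cls]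

lemma Hom.cproj_contractedMap {F F' : BunH P} (u : Hom F F') {S : Sch k}
    (q : F.bundle.contractedProduct.Sec S) :
    F'.bundle.cproj (EtSheaf.ap u.contractedMap q) = F.bundle.cproj q ≫ C.total ◁ u.base :=
  HBundle.hom_ext q fun a x hx => by
    rw [HBundle.comp_cproj _ a _ (u.res_contractedMap a q x hx), u.proj_pairMap,
      ← HBundle.comp_cproj q a x hx, Category.assoc]

lemma Hom.contractedMap_csmul {F F' : BunH P} (u : Hom F F') {S : Sch k}
    (q : F.bundle.contractedProduct.Sec S) (g : S ⟶ G.X) :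
    EtSheaf.ap u.contractedMap (F.bundle.csmul q g) =
      F'.bundle.csmul (EtSheaf.ap u.contractedMap q) g :=
  HBundle.sec_ext q fun a x hx => by
    rw [u.res_contractedMap a _ _ (HBundle.res_csmul' q g a x hx),
      HBundle.res_csmul' _ g a _ (u.res_contractedMap a q x hx)]
    rfl

lemma Hom.contractedMap_cgsmul {F F' : BunH P} (u : Hom F F') {S : Sch k} (σ : Γ)
    (q : F.bundle.contractedProduct.Sec S) :
    EtSheaf.ap u.contractedMap (F.bundle.cgsmul σ q) =
      F'.bundle.cgsmul σ (EtSheaf.ap u.contractedMap q) :=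
  HBundle.sec_ext q fun a x hx => by
    rw [u.res_contractedMap a _ _ (HBundle.res_cgsmul' σ q a x hx),
      HBundle.res_cgsmul' σ _ a _ (u.res_contractedMap a q x hx)]
    rfl

/-- The `(Γ, G)`-bundle associated with an `H_P`-bundle. -/
def toBunG (F : BunH P) : BunG P where
  T := F.T
  bundle := F.bundle.contractedBundle
  sameLocalType := F.bundle.sameLocalType_contractedBundle

/-- The morphism of `(Γ, G)`-bundles associated with a morphism of `H_P`-bundles. -/
def Hom.toBunG {F F' : BunH P} (u : Hom F F') : F.toBunG ⟶ F'.toBunG where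
  base := u.base
  map := u.contractedMap
  proj_map q := u.cproj_contractedMap q
  map_smul q g := u.contractedMap_csmul q g
  map_gsmul σ q := u.contractedMap_cgsmul σ q

end BunH

/-- The functor from `H_P`-bundles to `(Γ, G)`-bundles given by the contracted product with `P`. -/
def contractedProductFunctor (P : GBundle ρ C) : BasedFunctor (bunH P) (bunG P) where
  obj F := BunH.toBunG F
  map u := BunH.Hom.toBunG u
  map_id F := BunG.Hom.ext rfl (HBundle.contractedProduct_hom_ext fun x =>
    BunH.Hom.contractedMap_cls _ x)
  map_comp {F F' F''} u v := BunG.Hom.ext rfl (HBundle.contractedProduct_hom_ext fun x => by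
    refine (BunH.Hom.contractedMap_cls _ x).trans ?_
    refine ((congrArg (EtSheaf.ap (BunH.Hom.contractedMap v))
      (BunH.Hom.contractedMap_cls u x)).trans (BunH.Hom.contractedMap_cls v _)).symm)
  w := rfl

/-! ### Morphisms of `(Γ, G)`-bundles are strongly Cartesian -/

namespace BunG

variable {P : GBundle ρ C}

lemma Hom.existsUnique_lift {Q Q' : BunG P} (u : Hom Q Q') {S : Sch k}
    (y : S ⟶ C.total ⊗ Q.T) (q' : Q'.bundle.sheaf.Sec S)
    (hq' : Q'.bundle.proj q' = y ≫ C.total ◁ u.base) :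
    ∃! q : Q.bundle.sheaf.Sec S, Q.bundle.proj q = y ∧ EtSheaf.ap u.map q = q' := by
  obtain ⟨q, ⟨hq, e⟩, hu⟩ := GBundle.existsUnique_of_equivariant Q.bundle Q'.bundle y
    (y ≫ C.total ◁ u.base) (fun _ q _ => EtSheaf.ap u.map q)
    (fun b q hq => by rw [u.proj_map, hq]; exact Category.assoc _ _ _)
    (fun _ q _ g _ => u.map_smul q g)
    (fun c _ q _ _ => EtSheaf.ap_res _ _ _) q' hq'
  exact ⟨q, ⟨hq.trans (Category.id_comp y), e⟩,
    fun q₂ h₂ => hu q₂ ⟨h₂.1.trans (Category.id_comp y).symm, h₂.2⟩⟩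

/-- The factorization sends `q` to the unique point that lies over the image of `q` under `g` and is
mapped by `u` to `v(q)`. Naturality and both equivariances follow from this uniqueness. -/
lemma Hom.existsUnique_comp_eq {Q Q' Q'' : BunG P} (u : Q ⟶ Q') (v : Q'' ⟶ Q')
    (g : Q''.T ⟶ Q.T) (hg : Hom.base v = g ≫ Hom.base u) :
    ∃! w : Q'' ⟶ Q, Hom.base w = g ∧ w ≫ u = v := by
  have hv {S : Sch k} (q : Q''.bundle.sheaf.Sec S) : Q'.bundle.proj (EtSheaf.ap (Hom.map v) q) =
      (Q''.bundle.proj q ≫ C.total ◁ g) ≫ C.total ◁ Hom.base u := by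
    rw [Hom.proj_map, hg, MonoidalCategory.whiskerLeft_comp]
    exact (Category.assoc _ _ _).symm
  choose w hw hu using fun (S : Sch k) (q : Q''.bundle.sheaf.Sec S) =>
    Hom.existsUnique_lift u _ _ (hv q)
  let w' : Q'' ⟶ Q :=
    { base := g
      map := ⟨{ app := fun S => ↾(w S.unop)
                naturality := fun S S' a => by
                  ext q
                  refine (hu _ (Q''.bundle.sheaf.res a.unop q)
                    (Q.bundle.sheaf.res a.unop (w S.unop q)) ⟨?_, ?_⟩).symm
                  · rw [Q.bundle.proj_res, (hw _ q).1, Q''.bundle.proj_res]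
                    exact (Category.assoc _ _ _).symm
                  · rw [EtSheaf.ap_res, (hw _ q).2, EtSheaf.ap_res] }⟩
      proj_map := fun q => (hw _ q).1
      map_smul := fun {S} q c => by
        refine (hu S _ _ ⟨?_, ?_⟩).symm
        · rw [Q.bundle.proj_smul, Q''.bundle.proj_smul]
          exact (hw _ q).1
        · rw [Hom.map_smul, Hom.map_smul]
          exact congrArg (Q'.bundle.smul · c) (hw _ q).2
      map_gsmul := fun {S} σ q => by
        refine (hu S _ _ ⟨?_, ?_⟩).symm
        · rw [Q.bundle.proj_gsmul, Q''.bundle.proj_gsmul]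
          refine (congrArg (· ≫ _) (hw _ q).1).trans ?_
          refine (Category.assoc _ _ _).trans (Eq.trans ?_ (Category.assoc _ _ _).symm)
          -- `Γ` acts on the factor `X̃` and `g` on the factor `T`, so the two commute.
          exact congrArg (Q''.bundle.proj q ≫ ·) (whisker_exchange _ _)
        · rw [Hom.map_gsmul, Hom.map_gsmul]
          exact congrArg (Q'.bundle.gsmul σ) (hw _ q).2 }
  refine ⟨w', ⟨rfl, Hom.ext hg.symm ?_⟩, fun w₂ h₂ => Hom.ext h₂.1 ?_⟩
  · apply Sheaf.hom_ext
    ext S q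
    exact (hw S.unop q).2
  · apply Sheaf.hom_ext
    ext S q
    refine hu S.unop q _ ⟨?_, ?_⟩
    · rw [← h₂.1]
      exact Hom.proj_map w₂ q
    · rw [← h₂.2]
      rfl

/-- The category of `(Γ, G)`-bundles is fibred in groupoids: all its morphisms are strongly
Cartesian. -/
lemma isStronglyCartesian {Q Q' : (bunG P).obj} (u : Q ⟶ Q') :
    (bunG P).p.IsStronglyCartesian ((bunG P).p.map u) u where
  universal_property' {Q''} g v hv := by
    have hg := IsHomLift.eq_of_isHomLift (bunG P).p (g ≫ (bunG P).p.map u) v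
    obtain ⟨w, ⟨hw, e⟩, hu⟩ := Hom.existsUnique_comp_eq u v g hg.symm
    refine ⟨w, ⟨?_, e⟩, fun w₂ h₂ => hu w₂ ⟨?_, h₂.2⟩⟩
    · subst hw
      exact IsHomLift.map (p := (bunG P).p) w
    · have := h₂.1
      exact (IsHomLift.eq_of_isHomLift (bunG P).p g w₂).symm

end BunG

end Bundles

end GammaBundle

end

theorem proposition3p1 {k : Type u} [Field k] {Γ : Type v} [Group Γ] [Finite Γ]
    (hΓ : ((Nat.card Γ : ℕ) : k) ≠ 0)
    (G : Grp (GammaBundle.Sch k)) [IsAffineHom G.X.hom] [LocallyOfFiniteType G.X.hom]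
    (ρ : Γ →* Aut G)
    (C : GammaBundle.EquivMap k Γ) (hC : C.IsRamifiedCovering)
    (P : GammaBundle.GBundle ρ C) :
    ∃ (Φ : BasedFunctor (GammaBundle.bunH P) (GammaBundle.bunG P))
      (e : ∀ F : GammaBundle.BunH P,
        F.bundle.contractedProduct ≅ (GammaBundle.BunG.bundle (Φ.obj F)).sheaf),
      (∀ F : GammaBundle.BunH P,
        GammaBundle.IsContractedProduct F (Φ.obj F) (Φ.w_obj F) (e F)) ∧
      (∀ (F F' : GammaBundle.BunH P) (u : F ⟶ F') (S : GammaBundle.Sch k)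
        (x : F.bundle.Pair S),
        GammaBundle.EtSheaf.ap (GammaBundle.BunG.Hom.map (Φ.map u))
            (GammaBundle.EtSheaf.ap (e F).hom (F.bundle.cls x)) =
          GammaBundle.EtSheaf.ap (e F').hom
            (F'.bundle.cls (GammaBundle.BunH.Hom.pairMap u x))) ∧
      (∀ (F F' : (GammaBundle.bunH P).obj) (u : F ⟶ F'),
        (GammaBundle.bunH P).p.IsStronglyCartesian ((GammaBundle.bunH P).p.map u) u →
        (GammaBundle.bunG P).p.IsStronglyCartesian
          ((GammaBundle.bunG P).p.map (Φ.map u)) (Φ.map u)) := by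
  -- The comparison isomorphisms are identities, since the total space of the associated bundle is
  -- the contracted product itself.
  refine ⟨GammaBundle.contractedProductFunctor P, fun F => Iso.refl _, fun F => ?_,
    fun F F' u S x => GammaBundle.BunH.Hom.contractedMap_cls u x,
    fun F F' u _ => GammaBundle.BunG.isStronglyCartesian _⟩
  refine ⟨fun x => ?_, fun x => ?_, fun x g => GammaBundle.HBundle.csmul_cls x g,
    fun σ x => GammaBundle.HBundle.cgsmul_cls σ x⟩
  · exact (congrArg (· ≫ fst _ _) (GammaBundle.HBundle.cproj_cls x)).trans (lift_fst _ _)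
  · refine (congrArg (· ≫ snd C.total F.T ≫ 𝟙 F.T) (GammaBundle.HBundle.cproj_cls x)).trans ?_
    rw [Category.comp_id]
    exact lift_snd _ _
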